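/- For a probability measure $\mu$ on $\mathbb{R}$ and $z\in\mathbb{C}\setminus\mathbb{R}$ let $H_\mu(z)=\left[\int_{\mathbb{R}}\frac{\mu(dx)}{z-x}\right]^{-1}$ be its reciprocal Cauchy transform, and let $M_k(\mu)=\int_{\mathbb R} x^k\,\mu(dx)$. The monotone convolution $\mu\triangleright\nu$ of two probability measures on $\mathbb{R}$ is the probability measure with $$H_{\mu\triangleright\nu}(z)=H_\mu(H_\nu(z)),\qquad \operatorname{Im} z\neq 0;$$ such a probability measure exists and is unique. The measures below may have noncompact support. (1) Let $\mu$ be a probability measure on $\mathbb{R}$ with finite moments of all orders, mean $0$ and variance $1$, and let $D_c\mu$ denote the image of $\mu$ under $x\mapsto cx$. Then the $N$-fold monotone convolution $D_{1/\sqrt N}\mu\triangleright\cdots\triangleright D_{1/\sqrt N}\mu$ converges weakly, as $N\to\infty$, to the arcsine law with mean $0$ and variance $1$, which has density $\frac{1}{\pi\sqrt{2-x^2}}$ on $(-\sqrt2,\sqrt2)$. (2) Let $\lambda>0$ and let $\mu^{(N)}$, $N\ge 1$, be probability measures on $\mathbb{R}$ with finite moments of all orders such that $N M_k(\mu^{(N)})\to\lambda$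 as $N\to\infty$ for every $k\ge1$. Then the $N$-fold monotone convolution $\mu^{(N)}\triangleright\cdots\triangleright\mu^{(N)}$ converges weakly, as $N\to\infty$, to the monotone Poisson distribution with parameter $\lambda$, that is, to the probability measure with moments $$M_n=\sum_{k=1}^{n}\frac{\lambda^k}{k!}\sum_{1=i_0<i_1<\cdots<i_{k-1}<i_k=n+1} i_0i_1\cdots i_{k-1},\qquad n\ge1;$$ a probability measure with these moments exists and is unique. -/

import Mathlib

open MeasureTheory ProbabilityTheory Filter Topology

noncomputable section

namespace MonotoneConv

/-- The Cauchy transform `G_μ(z) = ∫ μ(dx) / (z - x)`. -/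
def cauchyTransform (μ : ProbabilityMeasure ℝ) (z : ℂ) : ℂ :=
  ∫ x : ℝ, (z - (x : ℂ))⁻¹ ∂(μ : Measure ℝ)

/-- The reciprocal Cauchy transform `H_μ(z) = 1 / G_μ(z)`. -/
def recipCauchy (μ : ProbabilityMeasure ℝ) (z : ℂ) : ℂ :=
  (cauchyTransform μ z)⁻¹

/-- `ρ` is the monotone convolution of `μ` and `ν`: `H_ρ = H_μ ∘ H_ν` off the real axis. -/
def IsMonotoneConv (μ ν ρ : ProbabilityMeasure ℝ) : Prop :=
  ∀ z : ℂ, z.im ≠ 0 → recipCauchy ρ z = recipCauchy μ (recipCauchy ν z)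

/-- The monotone convolution `μ ▷ ν`: the probability measure with `H_{μ ▷ ν} = H_μ ∘ H_ν`. -/
def monotoneConv (μ ν : ProbabilityMeasure ℝ) : ProbabilityMeasure ℝ :=
  Classical.epsilon (IsMonotoneConv μ ν)

/-- The `N`-fold monotone convolution `μ ▷ ⋯ ▷ μ` for `N ≥ 1`; the value at `N = 0` is the
point mass at `0`, the neutral element. -/
def monotoneConvPow (μ : ProbabilityMeasure ℝ) : ℕ → ProbabilityMeasure ℝ
  | 0 => ⟨Measure.dirac 0, inferInstance⟩
  | 1 => μ
  | n + 2 => monotoneConv (monotoneConvPow μ (n + 1)) μ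

/-- The dilation `D_c μ`: the image of `μ` under `x ↦ c * x`. -/
def dilation (c : ℝ) (μ : ProbabilityMeasure ℝ) : ProbabilityMeasure ℝ :=
  μ.map (f := fun x : ℝ => c * x) (measurable_const_mul c).aemeasurable

/-- Finiteness of all moments. -/
def HasAllMoments (μ : ProbabilityMeasure ℝ) : Prop :=
  ∀ k : ℕ, Integrable (fun x : ℝ => x ^ k) (μ : Measure ℝ)

/-- The `k`-th moment `M_k(μ)`. -/
def moment (μ : ProbabilityMeasure ℝ) (k : ℕ) : ℝ :=
  ∫ x : ℝ, x ^ k ∂(μ : Measure ℝ)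

/-- The density `1 / (π √(2 - x²))` on `(-√2, √2)` of the arcsine law. -/
def arcsineDensity (x : ℝ) : ℝ := 1 / (Real.pi * √(2 - x ^ 2))

/-- The arcsine law with mean `0` and variance `1`, as a measure. -/
def arcsineMeasure : Measure ℝ :=
  (volume.restrict (Set.Ioo (-√2) √2)).withDensity (fun x => ENNReal.ofReal (arcsineDensity x))

theorem arcsineDensity_nonneg (x : ℝ) : 0 ≤ arcsineDensity x := by
  unfold arcsineDensity
  positivity

theorem hasDerivAt_arcsine_cdf {x : ℝ} (hx : x ∈ Set.Ioo (-√2) √2) :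
    HasDerivAt (fun y : ℝ => Real.arcsin (y / √2) / Real.pi) (arcsineDensity x) x := by
  have h2 : (0 : ℝ) < √2 := by positivity
  have hl : x / √2 ≠ -1 := by
    intro h
    rw [div_eq_iff h2.ne'] at h
    linarith [hx.1]
  have hr : x / √2 ≠ 1 := by
    intro h
    rw [div_eq_iff h2.ne'] at h
    linarith [hx.2]
  have hd := ((Real.hasDerivAt_arcsin hl hr).comp x ((hasDerivAt_id x).div_const √2)).div_const
    Real.pi
  have he : √(2 - x ^ 2) = √(1 - (x / √2) ^ 2) * √2 := by
    rw [← Real.sqrt_mul' _ (by norm_num)]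
    congr 1
    rw [div_pow, Real.sq_sqrt (by norm_num)]
    ring
  refine hd.congr_deriv ?_
  unfold arcsineDensity
  rw [he]
  field_simp

instance : IsProbabilityMeasure arcsineMeasure := by
  have h2 : (0 : ℝ) < √2 := by positivity
  have hle : -√2 ≤ √2 := by linarith
  have hcont : ContinuousOn (fun y : ℝ => Real.arcsin (y / √2) / Real.pi)
      (Set.Icc (-√2) √2) := by
    apply Continuous.continuousOn
    fun_prop
  have hint := intervalIntegral.integrableOn_deriv_of_nonneg hcont
    (fun x hx => hasDerivAt_arcsine_cdf hx) (fun x _ => arcsineDensity_nonneg x)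
  have hval := intervalIntegral.integral_eq_sub_of_hasDerivAt_of_le hle hcont
    (fun x hx => hasDerivAt_arcsine_cdf hx)
    ((intervalIntegrable_iff_integrableOn_Ioc_of_le hle).2 hint)
  have h1 : ∫ x in Set.Ioo (-√2) √2, arcsineDensity x = 1 := by
    rw [← integral_Ioc_eq_integral_Ioo, ← intervalIntegral.integral_of_le hle, hval]
    have : -√2 / √2 = -1 := by field_simp
    rw [this, div_self h2.ne', Real.arcsin_one, Real.arcsin_neg_one]
    field_simp
    norm_num
  constructor
  rw [arcsineMeasure, withDensity_apply _ MeasurableSet.univ, Measure.restrict_univ,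
    ← ofReal_integral_eq_lintegral_ofReal (hint.mono_set Set.Ioo_subset_Ioc_self)
      (Eventually.of_forall arcsineDensity_nonneg), h1, ENNReal.ofReal_one]

/-- The arcsine law with mean `0` and variance `1`. -/
def arcsineLaw : ProbabilityMeasure ℝ := ⟨arcsineMeasure, inferInstance⟩

/-- The moments
`∑_{k=1}^n (c^k / k!) ∑_{1 = i₀ < i₁ < ⋯ < i_{k-1} < i_k = n+1} i₀ i₁ ⋯ i_{k-1}`
of the monotone Poisson distribution with parameter `c`, for `n ≥ 1`. The inner sum runs over the
sets `s = {i₀, …, i_{k-1}}`, i.e. the `k`-element subsets of `{1, …, n}` that contain `1`. -/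
def monotonePoissonMoment (c : ℝ) (n : ℕ) : ℝ :=
  ∑ k ∈ Finset.Icc 1 n, c ^ k / (k.factorial : ℝ) *
    ∑ s ∈ (Finset.powersetCard k (Finset.Icc 1 n)).filter (fun s => 1 ∈ s), ∏ i ∈ s, (i : ℝ)

/-- `ρ` is a probability measure with the monotone Poisson moments of parameter `c`. -/
def IsMonotonePoisson (c : ℝ) (ρ : ProbabilityMeasure ℝ) : Prop :=
  HasAllMoments ρ ∧ ∀ n : ℕ, 1 ≤ n → moment ρ n = monotonePoissonMoment c n

/-- The monotone Poisson distribution with parameter `c`: the probability measure with the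
monotone Poisson moments (their moment problem is determinate). -/
def monotonePoisson (c : ℝ) : ProbabilityMeasure ℝ :=
  Classical.epsilon (IsMonotonePoisson c)

end MonotoneConv

end

/-!
On the upper half-plane the Cauchy transform of the `N`-fold monotone convolution is `1 / H^N`,
where `H^N` is the `N`-th iterate of `H = H_μ`. So both limit theorems are statements about iterates
of a map close to the identity, and convergence of Cauchy transforms high up in the half-plane
suffices.

*Existence of the convolution.* If `ν` is finitely supported and `μ` is the point mass at `c`, then
`1 / (H_ν - c)` is the Cauchy transform of the spectral measure of a rank-one perturbation of a
diagonal matrix. Mixtures over `c` and weak limits then give all `μ` and `ν`.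

*Central limit theorem.* For mean `0` and variance `1` one has `H(w) - w ≈ -1 / w`, hence each step
of the iteration changes `H² - z²` by about `-2`. After `N` steps of the measure rescaled by
`1 / √N` this gives `H^N(z)² ≈ z² - 2`, and `√(z² - 2)` is the reciprocal Cauchy transform of the
arcsine law.

*Law of small numbers.* Here `H(w) - w ≈ (c / N) V(w)` with `V(w) = -w / (w - 1)`, so `H^N`
approximates the time-`c` flow of `V`. The recursion for the monotone Poisson moments says precisely
that their generating series `Q(t, z) = ∑ M_n(t) z^{-n-1}` solves `∂ₜ Q = V ∂_z Q` with
`Q(0, z) = 1 / z`. Thus `Q` is constant along trajectories if the parameter `t` decreases with time,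
and `1 / H^N(z) → Q(c, z)`. Applied to Bernoulli laws, this exhibits `Q(c, ·)` as a limit of Cauchy
transforms, which gives the existence of the monotone Poisson distribution.
-/

namespace MonotoneConv

section Kernel

variable {m : Measure ℝ} {f : ℝ → ℝ} {z : ℂ}

theorem sub_ofReal_ne_zero (hz : z.im ≠ 0) (x : ℝ) : z - x ≠ 0 := fun h ↦
  hz (by simpa using congrArg Complex.im h)

theorem norm_inv_sub_ofReal_le (hz : z.im ≠ 0) (x : ℝ) : ‖(z - x)⁻¹‖ ≤ |z.im|⁻¹ := by
  rw [norm_inv]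
  exact inv_anti₀ (abs_pos.2 hz) (by simpa using Complex.abs_im_le_norm (z - x))

theorem norm_ofReal_mul_inv_sub_ofReal_le (hz : z.im ≠ 0) (x : ℝ) :
    ‖(x : ℂ) * (z - x)⁻¹‖ ≤ ‖z‖ * |z.im|⁻¹ + 1 := by
  have hne := sub_ofReal_ne_zero hz x
  calc ‖(x : ℂ) * (z - x)⁻¹‖ = ‖z * (z - x)⁻¹ - 1‖ := by congr 1; field_simp; ring
    _ ≤ ‖z‖ * ‖(z - x)⁻¹‖ + 1 := by simpa using norm_sub_le (z * (z - x)⁻¹) 1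
    _ ≤ ‖z‖ * |z.im|⁻¹ + 1 := by
      gcongr
      exact norm_inv_sub_ofReal_le hz x

theorem norm_inv_sub_ofReal_sq (z : ℂ) (x : ℝ) :
    ‖(z - x)⁻¹‖ ^ 2 = ((z.re - x) ^ 2 + z.im ^ 2)⁻¹ := by
  rw [norm_inv, inv_pow, ← Complex.normSq_eq_norm_sq, Complex.normSq_apply]
  simp [sq]

theorem im_inv_sub_ofReal (z : ℂ) (x : ℝ) : (z - x)⁻¹.im = -(z.im * ‖(z - x)⁻¹‖ ^ 2) := by
  rw [Complex.inv_im, norm_inv, inv_pow, ← Complex.normSq_eq_norm_sq]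
  simp [div_eq_mul_inv]

theorem continuous_inv_sub_ofReal (hz : z.im ≠ 0) : Continuous fun x : ℝ ↦ (z - x)⁻¹ :=
  (continuous_const.sub Complex.continuous_ofReal).inv₀ (sub_ofReal_ne_zero hz)

theorem integrable_inv_sub_ofReal [IsFiniteMeasure m] (hz : z.im ≠ 0) :
    Integrable (fun x : ℝ ↦ (z - x)⁻¹) m :=
  .of_bound (continuous_inv_sub_ofReal hz).aestronglyMeasurable _
    (.of_forall (norm_inv_sub_ofReal_le hz))

theorem integrable_norm_inv_sub_ofReal_sq [IsFiniteMeasure m] (hz : z.im ≠ 0) :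
    Integrable (fun x : ℝ ↦ ‖(z - x)⁻¹‖ ^ 2) m := by
  refine .of_bound ((continuous_inv_sub_ofReal hz).norm.pow 2).aestronglyMeasurable
    (|z.im|⁻¹ ^ 2) (.of_forall fun x ↦ ?_)
  rw [norm_pow, norm_norm]
  gcongr
  exact norm_inv_sub_ofReal_le hz x

theorem integrable_mul_inv_sub_ofReal (hf : Integrable f m) (hz : z.im ≠ 0) :
    Integrable (fun x : ℝ ↦ (f x : ℂ) * (z - x)⁻¹) m :=
  hf.ofReal.mul_bdd (c := |z.im|⁻¹) (continuous_inv_sub_ofReal hz).aestronglyMeasurable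
    (.of_forall (norm_inv_sub_ofReal_le hz))

end Kernel

/-- The Cauchy transform `∫ f(x) / (z - x) m(dx)` of the signed measure `f · m`. The transforms of
`x ^ k · m` are the remainders of the expansion of the Cauchy transform of `m` at infinity. -/
noncomputable def weightedCauchy (m : Measure ℝ) (f : ℝ → ℝ) (z : ℂ) : ℂ :=
  ∫ x : ℝ, (f x : ℂ) * (z - x)⁻¹ ∂m

theorem integrable_pow_of_le {m : Measure ℝ} [IsFiniteMeasure m] {p q : ℕ} (hpq : p ≤ q)
    (hq : Integrable (fun x ↦ x ^ q) m) : Integrable (fun x ↦ x ^ p) m := by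
  refine ((integrable_const 1).add hq.abs).mono' (by fun_prop) (.of_forall fun x ↦ ?_)
  simp only [Real.norm_eq_abs, abs_pow, Pi.add_apply]
  rcases le_total |x| 1 with hx | hx
  · linarith [pow_le_one₀ (n := p) (abs_nonneg x) hx, pow_nonneg (abs_nonneg x) q]
  · linarith [pow_le_pow_right₀ hx hpq]

section WeightedCauchy

variable {m : Measure ℝ} {f : ℝ → ℝ} {z : ℂ}

theorem cauchyTransform_eq_weightedCauchy (μ : ProbabilityMeasure ℝ) (z : ℂ) :
    cauchyTransform μ z = weightedCauchy μ (fun _ ↦ 1) z := by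
  simp [cauchyTransform, weightedCauchy]

theorem norm_weightedCauchy_le (hf : Integrable f m) (hz : z.im ≠ 0) :
    ‖weightedCauchy m f z‖ ≤ |z.im|⁻¹ * ∫ x, |f x| ∂m := by
  rw [← integral_const_mul]
  refine norm_integral_le_of_norm_le (hf.abs.const_mul _) (.of_forall fun x ↦ ?_)
  rw [norm_mul, Complex.norm_real, Real.norm_eq_abs, mul_comm]
  gcongr
  exact norm_inv_sub_ofReal_le hz x

theorem sub_ofReal_mul_weightedCauchy (hf : Integrable f m) (hz : z.im ≠ 0) (a : ℝ) :
    (z - a) * weightedCauchy m f z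
      = (∫ x, f x ∂m : ℝ) + weightedCauchy m (fun x ↦ (x - a) * f x) z := by
  have hsplit (x : ℝ) :
      (((x - a) * f x : ℝ) : ℂ) * (z - x)⁻¹ = (z - a) * (f x * (z - x)⁻¹) - f x := by
    have := sub_ofReal_ne_zero hz x
    push_cast
    field_simp
    ring
  simp only [weightedCauchy, hsplit]
  have hfC : Integrable (fun x ↦ (f x : ℂ)) m := hf.ofReal
  rw [integral_sub ((integrable_mul_inv_sub_ofReal hf hz).const_mul (z - a)) hfC,
    integral_const_mul, integral_complex_ofReal]
  ring

theorem mul_weightedCauchy (hf : Integrable f m) (hz : z.im ≠ 0) :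
    z * weightedCauchy m f z = (∫ x, f x ∂m : ℝ) + weightedCauchy m (fun x ↦ x * f x) z := by
  simpa using sub_ofReal_mul_weightedCauchy hf hz 0

/-- The factor `x` is absorbed by the kernel: `‖x / (w - x)‖ ≤ C + 1`. -/
theorem tendsto_weightedCauchy_id_mul {ι : Type*} {l : Filter ι} [l.IsCountablyGenerated]
    (hf : Integrable f m) {w : ι → ℂ} {C : ℝ} (hw : Tendsto (fun i ↦ (w i).im) l atTop)
    (hC : ∀ᶠ i in l, ‖w i‖ ≤ C * (w i).im) :
    Tendsto (fun i ↦ weightedCauchy m (fun x ↦ x * f x) (w i)) l (𝓝 0) := by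
  have him : ∀ᶠ i in l, 0 < (w i).im := hw.eventually_gt_atTop 0
  rw [← integral_zero ℝ ℂ (μ := m)]
  refine tendsto_integral_filter_of_dominated_convergence (fun x ↦ (C + 1) * |f x|) ?_ ?_
    (hf.abs.const_mul _) (.of_forall fun x ↦ ?_)
  · filter_upwards [him] with i hi
    exact ((Complex.measurable_ofReal.comp measurable_id).aestronglyMeasurable.mul
      hf.ofReal.aestronglyMeasurable |>.congr (by simp [EventuallyEq])).mul
        (continuous_inv_sub_ofReal hi.ne').aestronglyMeasurable
  · filter_upwards [him, hC] with i hi hCi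
    refine .of_forall fun x ↦ ?_
    have hkernel : ‖(x : ℂ) * (w i - x)⁻¹‖ ≤ C + 1 := by
      refine (norm_ofReal_mul_inv_sub_ofReal_le hi.ne' x).trans ?_
      rw [abs_of_pos hi, ← div_eq_mul_inv]
      gcongr
      exact (div_le_iff₀ hi).2 hCi
    calc ‖((x * f x : ℝ) : ℂ) * (w i - x)⁻¹‖ = ‖(x : ℂ) * (w i - x)⁻¹‖ * |f x| := by
          push_cast
          simp only [norm_mul, Complex.norm_real, Real.norm_eq_abs]
          ring
      _ ≤ (C + 1) * |f x| := by gcongr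
  · refine squeeze_zero_norm' (a := fun i ↦ |x * f x| * (w i).im⁻¹) ?_
      (by simpa using (tendsto_inv_atTop_zero.comp hw).const_mul |x * f x|)
    filter_upwards [him] with i hi
    rw [norm_mul, Complex.norm_real, Real.norm_eq_abs]
    gcongr
    simpa [abs_of_pos hi] using norm_inv_sub_ofReal_le hi.ne' x

theorem tendsto_weightedCauchy_id_mul_I (hf : Integrable f m) :
    Tendsto (fun y : ℝ ↦ weightedCauchy m (fun x ↦ x * f x) (y * Complex.I)) atTop (𝓝 0) := by
  refine tendsto_weightedCauchy_id_mul (C := 1) hf (tendsto_id.congr fun y ↦ by simp) ?_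
  filter_upwards [eventually_gt_atTop 0] with y hy
  simp [abs_of_pos hy]

theorem integrable_sq_div_sq_add_sq_mul (hf : Integrable f m) (y : ℝ) :
    Integrable (fun x ↦ x ^ 2 / (x ^ 2 + y ^ 2) * f x) m := by
  refine hf.bdd_mul (c := 1) (Measurable.aestronglyMeasurable (by fun_prop)) (.of_forall fun x ↦ ?_)
  rw [Real.norm_of_nonneg (by positivity)]
  exact div_le_one_of_le₀ (by nlinarith) (by positivity)

theorem integral_sub_re_mul_weightedCauchy_mul_I (hf : Integrable f m) {y : ℝ} (hy : y ≠ 0) :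
    ∫ x, f x ∂m - (y * Complex.I * weightedCauchy m f (y * Complex.I)).re
      = ∫ x, x ^ 2 / (x ^ 2 + y ^ 2) * f x ∂m := by
  have hz : (y * Complex.I).im ≠ 0 := by simpa
  have hint := (integrable_mul_inv_sub_ofReal hf hz).const_mul (y * Complex.I)
  have hre := integral_re hint
  simp only [RCLike.re_to_complex] at hre
  rw [weightedCauchy, ← integral_const_mul, ← hre, ← integral_sub hf (by simpa using hint.re)]
  refine integral_congr_ae (.of_forall fun x ↦ ?_)
  have hne : x ^ 2 + y ^ 2 ≠ 0 := by positivity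
  have hnormSq : Complex.normSq (y * Complex.I - x) = x ^ 2 + y ^ 2 := by
    simp [Complex.normSq_apply, sq]
  simp only [Complex.mul_re, Complex.ofReal_re, Complex.I_re, mul_zero, Complex.ofReal_im,
    Complex.I_im, mul_one, sub_self, Complex.inv_re, Complex.sub_re, zero_sub, hnormSq,
    Complex.inv_im, Complex.sub_im, Complex.mul_im, add_zero, sub_zero, zero_mul, sub_neg_eq_add]
  field_simp
  ring

end WeightedCauchy

section CauchyTransform

variable {μ ν : ProbabilityMeasure ℝ} {z : ℂ}

theorem cauchyTransform_conj (μ : ProbabilityMeasure ℝ) (z : ℂ) :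
    cauchyTransform μ (starRingEnd ℂ z) = starRingEnd ℂ (cauchyTransform μ z) := by
  rw [cauchyTransform, cauchyTransform, ← integral_conj]
  simp

theorem recipCauchy_conj (μ : ProbabilityMeasure ℝ) (z : ℂ) :
    recipCauchy μ (starRingEnd ℂ z) = starRingEnd ℂ (recipCauchy μ z) := by
  simp [recipCauchy, cauchyTransform_conj]

theorem inv_recipCauchy (μ : ProbabilityMeasure ℝ) (z : ℂ) :
    (recipCauchy μ z)⁻¹ = cauchyTransform μ z :=
  inv_inv _

theorem im_cauchyTransform (μ : ProbabilityMeasure ℝ) (hz : z.im ≠ 0) :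
    (cauchyTransform μ z).im = -(z.im * ∫ x : ℝ, ‖(z - x)⁻¹‖ ^ 2 ∂(μ : Measure ℝ)) := by
  have him := integral_im (integrable_inv_sub_ofReal (m := μ) hz)
  simp only [RCLike.im_to_complex] at him
  rw [cauchyTransform, ← him, ← integral_const_mul, ← integral_neg]
  simp_rw [im_inv_sub_ofReal]

theorem norm_cauchyTransform_sq_le (μ : ProbabilityMeasure ℝ) (hz : z.im ≠ 0) :
    ‖cauchyTransform μ z‖ ^ 2 ≤ ∫ x : ℝ, ‖(z - x)⁻¹‖ ^ 2 ∂(μ : Measure ℝ) :=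
  ((convexOn_univ_norm (E := ℂ)).pow (fun _ _ ↦ norm_nonneg _) 2).map_integral_le
    (continuous_norm.pow 2).continuousOn isClosed_univ (.of_forall fun _ ↦ Set.mem_univ _)
    (integrable_inv_sub_ofReal hz) (integrable_norm_inv_sub_ofReal_sq hz)

theorem cauchyTransform_ne_zero (μ : ProbabilityMeasure ℝ) (hz : 0 < z.im) :
    cauchyTransform μ z ≠ 0 := by
  intro h
  have hint : ∫ x : ℝ, ‖(z - x)⁻¹‖ ^ 2 ∂(μ : Measure ℝ) = 0 := by
    have := im_cauchyTransform μ hz.ne'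
    rw [h] at this
    simpa [hz.ne'] using this
  rw [integral_eq_zero_iff_of_nonneg (fun x ↦ by positivity)
    (integrable_norm_inv_sub_ofReal_sq hz.ne')] at hint
  obtain ⟨x, hx⟩ := hint.exists
  simp [sub_ofReal_ne_zero hz.ne' x] at hx

theorem im_le_im_recipCauchy (μ : ProbabilityMeasure ℝ) (hz : 0 < z.im) :
    z.im ≤ (recipCauchy μ z).im := by
  have hpos : 0 < ‖cauchyTransform μ z‖ ^ 2 := by
    have := cauchyTransform_ne_zero μ hz
    positivity
  rw [recipCauchy, Complex.inv_im, Complex.normSq_eq_norm_sq, le_div_iff₀ hpos,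
    im_cauchyTransform μ hz.ne', neg_neg]
  exact mul_le_mul_of_nonneg_left (norm_cauchyTransform_sq_le μ hz.ne') hz.le

theorem recipCauchy_im_pos (μ : ProbabilityMeasure ℝ) (hz : 0 < z.im) : 0 < (recipCauchy μ z).im :=
  hz.trans_le (im_le_im_recipCauchy μ hz)

theorem im_le_im_iterate_recipCauchy (μ : ProbabilityMeasure ℝ) (n : ℕ) (hz : 0 < z.im) :
    z.im ≤ ((recipCauchy μ)^[n] z).im := by
  induction n with
  | zero => simp
  | succ n ih =>
    rw [Function.iterate_succ_apply']
    exact ih.trans (im_le_im_recipCauchy μ (hz.trans_le ih))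

theorem hasDerivAt_cauchyTransform (μ : ProbabilityMeasure ℝ) (hz : 0 < z.im) :
    HasDerivAt (cauchyTransform μ) (∫ x : ℝ, -((z - x) ^ 2)⁻¹ ∂(μ : Measure ℝ)) z := by
  have hs : {w : ℂ | z.im / 2 < w.im} ∈ 𝓝 z :=
    (isOpen_lt continuous_const Complex.continuous_im).mem_nhds (half_lt_self hz)
  have him {w : ℂ} (hw : w ∈ {w : ℂ | z.im / 2 < w.im}) : 0 < w.im := (half_pos hz).trans hw
  refine (hasDerivAt_integral_of_dominated_loc_of_deriv_le (F := fun (w : ℂ) (x : ℝ) ↦ (w - x)⁻¹)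
    (F' := fun (w : ℂ) (x : ℝ) ↦ -((w - x) ^ 2)⁻¹) (bound := fun _ ↦ (z.im / 2)⁻¹ ^ 2) hs ?_
    (integrable_inv_sub_ofReal hz.ne') ?_ (.of_forall fun x w hw ↦ ?_) (integrable_const _)
    (.of_forall fun x w hw ↦ ?_)).2
  · filter_upwards [hs] with w hw
    exact (continuous_inv_sub_ofReal (him hw).ne').aestronglyMeasurable
  · simp_rw [← inv_pow]
    exact ((continuous_inv_sub_ofReal hz.ne').pow 2).neg.aestronglyMeasurable
  · rw [norm_neg, ← inv_pow, norm_pow]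
    gcongr
    refine (norm_inv_sub_ofReal_le (him hw).ne' x).trans (inv_anti₀ (half_pos hz) ?_)
    exact (le_of_lt hw).trans (le_abs_self _)
  · refine (((hasDerivAt_id w).sub_const (x : ℂ)).inv
      (sub_ofReal_ne_zero (him hw).ne' x)).congr_deriv ?_
    simp [div_eq_mul_inv]

theorem mul_cauchyTransform (μ : ProbabilityMeasure ℝ) (hz : z.im ≠ 0) :
    z * cauchyTransform μ z = 1 + weightedCauchy μ (fun x ↦ x) z := by
  simpa [cauchyTransform_eq_weightedCauchy] using
    mul_weightedCauchy (integrable_const (1 : ℝ) (μ := (μ : Measure ℝ))) hz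

/-- The condition `hC` says that `w` tends to infinity nontangentially to the real axis. -/
theorem tendsto_mul_cauchyTransform {ι : Type*} {l : Filter ι} [l.IsCountablyGenerated]
    (μ : ProbabilityMeasure ℝ) {w : ι → ℂ} {C : ℝ} (hw : Tendsto (fun i ↦ (w i).im) l atTop)
    (hC : ∀ᶠ i in l, ‖w i‖ ≤ C * (w i).im) :
    Tendsto (fun i ↦ w i * cauchyTransform μ (w i)) l (𝓝 1) := by
  have hrem := (tendsto_weightedCauchy_id_mul (m := μ) (integrable_const (1 : ℝ)) hw hC).const_add 1
  simp only [mul_one, add_zero] at hrem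
  refine hrem.congr' ?_
  filter_upwards [hw.eventually_gt_atTop 0] with i hi using (mul_cauchyTransform μ hi.ne').symm

theorem tendsto_mul_cauchyTransform_I (μ : ProbabilityMeasure ℝ) :
    Tendsto (fun y : ℝ ↦ y * Complex.I * cauchyTransform μ (y * Complex.I)) atTop (𝓝 1) := by
  refine tendsto_mul_cauchyTransform (C := 1) μ (tendsto_id.congr fun y ↦ by simp) ?_
  filter_upwards [eventually_gt_atTop 0] with y hy
  simp [abs_of_pos hy]

theorem tendsto_cauchyTransform {ι : Type*} {l : Filter ι} {ρ : ι → ProbabilityMeasure ℝ}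
    (h : Tendsto ρ l (𝓝 μ)) (hz : z.im ≠ 0) :
    Tendsto (fun i ↦ cauchyTransform (ρ i) z) l (𝓝 (cauchyTransform μ z)) := by
  rw [ProbabilityMeasure.tendsto_iff_forall_integral_rclike_tendsto ℂ] at h
  exact h (.ofNormedAddCommGroup _ (continuous_inv_sub_ofReal hz) _ (norm_inv_sub_ofReal_le hz))

end CauchyTransform

section Inversion

variable {μ ν : ProbabilityMeasure ℝ}

theorem integral_add_mul_cauchyMeasure (g : ℝ → ℝ) (x : ℝ) {y : NNReal} (hy : y ≠ 0) :
    ∫ u, g (x + y * u) ∂cauchyMeasure 0 1 = ∫ t, g t * cauchyPDFReal x y t := by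
  have hy' : (y : ℝ) ≠ 0 := by exact_mod_cast hy
  have hscale (u : ℝ) : (cauchyPDF 0 1 u).toReal • g (x + y * u)
      = y * (fun t ↦ g t * cauchyPDFReal x y t) (x + y * u) := by
    have hne : (1 : ℝ) + u ^ 2 ≠ 0 := by positivity
    rw [cauchyPDF, ENNReal.toReal_ofReal (cauchyPDF_pos 0 one_ne_zero u).le, smul_eq_mul]
    simp only [cauchyPDFReal_def, add_sub_cancel_left, sub_zero, NNReal.coe_one, one_pow]
    rw [show ((y : ℝ) * u) ^ 2 + (y : ℝ) ^ 2 = y ^ 2 * (1 + u ^ 2) by ring, add_comm (u ^ 2)]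
    field_simp
  rw [cauchyMeasure_of_scale_ne_zero 0 one_ne_zero,
    integral_withDensity_eq_integral_toReal_smul (measurable_cauchyPDF 0 1)
      (.of_forall fun _ ↦ by simp [cauchyPDF])]
  simp_rw [hscale]
  rw [integral_const_mul, Measure.integral_comp_mul_left
    (fun v ↦ (fun t ↦ g t * cauchyPDFReal x y t) (x + v)),
    integral_add_left_eq_self (fun t ↦ g t * cauchyPDFReal x y t) x,
    smul_eq_mul, abs_of_nonneg (by positivity), mul_inv_cancel_left₀ hy']

theorem integrable_cauchyPDFReal_prod (m : Measure ℝ) [IsFiniteMeasure m] {y : NNReal}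
    (hy : y ≠ 0) : Integrable (fun p : ℝ × ℝ ↦ cauchyPDFReal p.1 y p.2) (m.prod volume) := by
  have hmeas : Measurable fun p : ℝ × ℝ ↦ cauchyPDFReal p.1 y p.2 := by
    unfold cauchyPDFReal
    fun_prop
  refine (integrable_prod_iff hmeas.aestronglyMeasurable).2
    ⟨.of_forall fun x ↦ integrable_cauchyPDFReal x, ?_⟩
  simp only [Real.norm_of_nonneg (cauchyPDF_pos _ hy _).le, integral_cauchyPDFReal_eq_one _ hy]
  exact integrable_const _

theorem integral_cauchyPDFReal (μ : ProbabilityMeasure ℝ) {y : NNReal} (hy : y ≠ 0) (t : ℝ) :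
    ∫ x, cauchyPDFReal x y t ∂(μ : Measure ℝ)
      = -(Real.pi⁻¹ * (cauchyTransform μ (t + y * Complex.I)).im) := by
  have him : (t + y * Complex.I : ℂ).im = y := by simp
  rw [im_cauchyTransform μ (by simpa using hy), him]
  simp only [norm_inv_sub_ofReal_sq, cauchyPDFReal_def, integral_const_mul, him]
  simp
  ring

/-- Stieltjes inversion: convolving `μ` with the Cauchy law of scale `y` gives the density
`-Im G_μ(t + iy) / π`. -/
theorem integral_add_mul_prod_cauchyMeasure (μ : ProbabilityMeasure ℝ)
    (f : BoundedContinuousFunction ℝ ℝ) {y : NNReal} (hy : y ≠ 0) :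
    ∫ p : ℝ × ℝ, f (p.1 + y * p.2) ∂(μ : Measure ℝ).prod (cauchyMeasure 0 1)
      = ∫ t : ℝ, f t * -(Real.pi⁻¹ * (cauchyTransform μ (t + y * Complex.I)).im) := by
  have hint : Integrable (fun p : ℝ × ℝ ↦ f (p.1 + y * p.2))
      ((μ : Measure ℝ).prod (cauchyMeasure 0 1)) :=
    .of_bound (Continuous.aestronglyMeasurable (by fun_prop)) ‖f‖
      (.of_forall fun p ↦ f.norm_coe_le_norm _)
  rw [integral_prod _ hint]
  simp only [integral_add_mul_cauchyMeasure f _ hy]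
  rw [integral_integral_swap]
  · simp only [integral_const_mul, integral_cauchyPDFReal μ hy]
  · exact (integrable_cauchyPDFReal_prod _ hy).bdd_mul (c := ‖f‖)
      (f.continuous.comp continuous_snd).aestronglyMeasurable
      (.of_forall fun p ↦ f.norm_coe_le_norm p.2)

theorem tendsto_integral_add_mul_prod (m κ : Measure ℝ) [IsFiniteMeasure m]
    [IsProbabilityMeasure κ] (f : BoundedContinuousFunction ℝ ℝ) :
    Tendsto (fun y : NNReal ↦ ∫ p : ℝ × ℝ, f (p.1 + y * p.2) ∂m.prod κ) (𝓝[≠] 0)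
      (𝓝 (∫ x, f x ∂m)) := by
  have hlim : ∫ x, f x ∂m = ∫ p : ℝ × ℝ, f p.1 ∂m.prod κ := by
    simp [integral_fun_fst (f : ℝ → ℝ)]
  rw [hlim]
  refine tendsto_integral_filter_of_dominated_convergence (fun _ ↦ ‖f‖)
    (.of_forall fun y ↦ Continuous.aestronglyMeasurable (by fun_prop))
    (.of_forall fun y ↦ .of_forall fun p ↦ f.norm_coe_le_norm _) (integrable_const _)
    (.of_forall fun p ↦ ?_)
  have hcont : Continuous fun y : NNReal ↦ f (p.1 + y * p.2) := by fun_prop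
  simpa using hcont.continuousAt.tendsto.mono_left (nhdsWithin_le_nhds (a := 0) (s := {0}ᶜ))

theorem eq_of_cauchyTransform_eq
    (h : ∀ z : ℂ, 0 < z.im → cauchyTransform μ z = cauchyTransform ν z) : μ = ν := by
  refine Subtype.ext (ext_of_forall_integral_eq_of_IsFiniteMeasure (μ := (μ : Measure ℝ))
    (ν := (ν : Measure ℝ)) fun f ↦ ?_)
  refine tendsto_nhds_unique (tendsto_integral_add_mul_prod μ (cauchyMeasure 0 1) f)
    ((tendsto_integral_add_mul_prod ν (cauchyMeasure 0 1) f).congr' ?_)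
  filter_upwards [self_mem_nhdsWithin] with y hy
  have him (t : ℝ) : 0 < (t + y * Complex.I : ℂ).im := by simpa using pos_iff_ne_zero.2 hy
  rw [integral_add_mul_prod_cauchyMeasure μ f hy, integral_add_mul_prod_cauchyMeasure ν f hy]
  simp only [h _ (him _)]

theorem analyticOnNhd_cauchyTransform (μ : ProbabilityMeasure ℝ) :
    AnalyticOnNhd ℂ (cauchyTransform μ) {z : ℂ | 0 < z.im} :=
  DifferentiableOn.analyticOnNhd
    (fun _ hz ↦ (hasDerivAt_cauchyTransform μ hz).differentiableAt.differentiableWithinAt)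
    (isOpen_lt continuous_const Complex.continuous_im)

theorem eq_of_cauchyTransform_eq_of_im_gt {R : ℝ} (hR : 0 ≤ R)
    (h : ∀ z : ℂ, R < z.im → cauchyTransform μ z = cauchyTransform ν z) : μ = ν := by
  refine eq_of_cauchyTransform_eq ?_
  have hz₀ : R < ((R + 1 : ℝ) * Complex.I : ℂ).im := by simp
  refine (analyticOnNhd_cauchyTransform μ).eqOn_of_preconnected_of_eventuallyEq
    (analyticOnNhd_cauchyTransform ν) (convex_halfSpace_im_gt 0).isPreconnected
    (hR.trans_lt hz₀) ?_
  filter_upwards [(isOpen_lt continuous_const Complex.continuous_im).mem_nhds hz₀] with z hz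
    using h z hz

end Inversion

section WeakLimits

variable {ρ : ℕ → ProbabilityMeasure ℝ} {R : ℝ}

theorem measureReal_le_abs_le (μ : ProbabilityMeasure ℝ) {y : ℝ} (hy : 0 < y) :
    (μ : Measure ℝ).real {x | y ≤ |x|} ≤
      2 * (1 - (y * Complex.I * cauchyTransform μ (y * Complex.I)).re) := by
  have hone : Integrable (fun _ : ℝ ↦ (1 : ℝ)) (μ : Measure ℝ) := integrable_const _
  have hre := integral_sub_re_mul_weightedCauchy_mul_I hone hy.ne'
  rw [← cauchyTransform_eq_weightedCauchy] at hre
  simp only [integral_const, probReal_univ, smul_eq_mul, mul_one] at hre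
  have hmarkov := mul_meas_ge_le_integral_of_nonneg (μ := (μ : Measure ℝ))
    (f := fun x ↦ x ^ 2 / (x ^ 2 + y ^ 2)) (.of_forall fun x ↦ by positivity)
    (by simpa using integrable_sq_div_sq_add_sq_mul hone y) (1 / 2)
  have hsub : {x : ℝ | y ≤ |x|} ⊆ {x | 1 / 2 ≤ x ^ 2 / (x ^ 2 + y ^ 2)} := by
    intro x (hx : y ≤ |x|)
    have hyx : y ^ 2 ≤ x ^ 2 := sq_le_sq.2 (by rwa [abs_of_pos hy])
    change 1 / 2 ≤ x ^ 2 / (x ^ 2 + y ^ 2)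
    rw [le_div_iff₀ (by positivity)]
    linarith
  have hmono := measureReal_mono (μ := (μ : Measure ℝ)) hsub
  rw [hre]
  linarith

theorem isTightMeasureSet_of_tendsto_cauchyTransform {F : ℝ → ℂ}
    (h : ∀ y : ℝ, R < y → Tendsto (fun n ↦ cauchyTransform (ρ n) (y * Complex.I)) atTop (𝓝 (F y)))
    (hF : Tendsto (fun y : ℝ ↦ y * Complex.I * F y) atTop (𝓝 1)) :
    IsTightMeasureSet (Set.range fun n ↦ (ρ n : Measure ℝ)) := by
  have hbound : Tendsto (fun w : ℂ ↦ ENNReal.ofReal (2 * (1 - w.re))) (𝓝 1) (𝓝 0) := by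
    have hcont : Continuous fun w : ℂ ↦ ENNReal.ofReal (2 * (1 - w.re)) :=
      ENNReal.continuous_ofReal.comp (by fun_prop)
    simpa using hcont.tendsto 1
  refine isTightMeasureSet_range_of_tendsto_limsup_measure_norm_gt ?_
  refine tendsto_of_tendsto_of_tendsto_of_le_of_le' tendsto_const_nhds (hbound.comp hF)
    (.of_forall fun _ ↦ bot_le) ?_
  filter_upwards [eventually_gt_atTop R, eventually_gt_atTop 0] with y hyR hy
  have hcont : Continuous fun w : ℂ ↦ ENNReal.ofReal (2 * (1 - (y * Complex.I * w).re)) :=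
    ENNReal.continuous_ofReal.comp (by fun_prop)
  change _ ≤ ENNReal.ofReal (2 * (1 - (y * Complex.I * F y).re))
  rw [← ((hcont.tendsto _).comp (h y hyR)).limsup_eq]
  refine limsup_le_limsup (.of_forall fun n ↦ ?_)
  refine (measure_mono fun x (hx : y < ‖x‖) ↦ hx.le).trans
    ((ENNReal.le_ofReal_iff_toReal_le (measure_ne_top _ _) ?_).2 (measureReal_le_abs_le (ρ n) hy))
  exact measureReal_nonneg.trans (measureReal_le_abs_le (ρ n) hy)

theorem exists_tendsto_ultrafilter_of_isTightMeasureSet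
    (h : IsTightMeasureSet (Set.range fun n ↦ (ρ n : Measure ℝ))) (U : Ultrafilter ℕ) :
    ∃ ν, Tendsto ρ U (𝓝 ν) := by
  have hc : IsCompact (closure (Set.range ρ)) := by
    refine isCompact_closure_of_isTightMeasureSet ?_
    convert h using 1
    ext
    simp
  obtain ⟨ν, -, hν⟩ := hc.ultrafilter_le_nhds (U.map ρ)
    (.trans (by simp) (monotone_principal subset_closure))
  exact ⟨ν, hν⟩

theorem exists_cauchyTransform_eq_of_tendsto {F : ℂ → ℂ} (hR : 0 ≤ R)
    (h : ∀ z : ℂ, R < z.im → Tendsto (fun n ↦ cauchyTransform (ρ n) z) atTop (𝓝 (F z)))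
    (hF : Tendsto (fun y : ℝ ↦ y * Complex.I * F (y * Complex.I)) atTop (𝓝 1)) :
    ∃ ν : ProbabilityMeasure ℝ, ∀ z : ℂ, R < z.im → cauchyTransform ν z = F z := by
  obtain ⟨ν, hν⟩ := exists_tendsto_ultrafilter_of_isTightMeasureSet
    (isTightMeasureSet_of_tendsto_cauchyTransform (F := fun y ↦ F (y * Complex.I)) (R := R)
      (fun y hy ↦ h _ (by simpa using hy)) hF) (hyperfilter ℕ)
  exact ⟨ν, fun z hz ↦ tendsto_nhds_unique (tendsto_cauchyTransform hν (hR.trans_lt hz).ne')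
    ((h z hz).mono_left (by simpa using Nat.hyperfilter_le_atTop))⟩

theorem tendsto_of_tendsto_cauchyTransform {ν : ProbabilityMeasure ℝ} (hR : 0 ≤ R)
    (h : ∀ z : ℂ, R < z.im →
      Tendsto (fun n ↦ cauchyTransform (ρ n) z) atTop (𝓝 (cauchyTransform ν z))) :
    Tendsto ρ atTop (𝓝 ν) := by
  have htight := isTightMeasureSet_of_tendsto_cauchyTransform
    (F := fun y ↦ cauchyTransform ν (y * Complex.I)) (R := R)
    (fun y hy ↦ h _ (by simpa using hy)) (tendsto_mul_cauchyTransform_I ν)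
  refine (tendsto_iff_ultrafilter _ _ _).2 fun U hU ↦ ?_
  obtain ⟨ν', hν'⟩ := exists_tendsto_ultrafilter_of_isTightMeasureSet htight U
  have hlim : ν' = ν := eq_of_cauchyTransform_eq_of_im_gt hR fun z hz ↦
    tendsto_nhds_unique (tendsto_cauchyTransform hν' (hR.trans_lt hz).ne') ((h z hz).mono_left hU)
  rwa [← hlim]

end WeakLimits

section FiniteSupport

theorem exists_cauchyTransform_eq_sum {ι : Type*} {s : Finset ι} {w : ι → ℝ}
    (hw : ∀ i ∈ s, 0 ≤ w i) (hsum : ∑ i ∈ s, w i = 1) (ρ : ι → ProbabilityMeasure ℝ) :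
    ∃ σ : ProbabilityMeasure ℝ, ∀ z : ℂ, z.im ≠ 0 →
      cauchyTransform σ z = ∑ i ∈ s, w i * cauchyTransform (ρ i) z := by
  have hprob : IsProbabilityMeasure
      (∑ i ∈ s, ENNReal.ofReal (w i) • (ρ i : Measure ℝ)) := by
    constructor
    simp [← ENNReal.ofReal_sum_of_nonneg hw, hsum]
  refine ⟨⟨_, hprob⟩, fun z hz ↦ ?_⟩
  have hint (i : ι) (_ : i ∈ s) :
      Integrable (fun x : ℝ ↦ (z - x)⁻¹) (ENNReal.ofReal (w i) • (ρ i : Measure ℝ)) :=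
    (integrable_inv_sub_ofReal hz).smul_measure ENNReal.ofReal_ne_top
  simp only [cauchyTransform, ProbabilityMeasure.coe_mk, integral_finsetSum_measure hint,
    integral_smul_measure]
  exact Finset.sum_congr rfl fun i hi ↦ by rw [ENNReal.toReal_ofReal (hw i hi), Complex.real_smul]

theorem cauchyTransform_diracProba (c : ℝ) (z : ℂ) :
    cauchyTransform (diracProba c) z = (z - c)⁻¹ := by
  simp [cauchyTransform, diracProba]

theorem integral_simpleFunc_comp {α β E : Type*} [MeasurableSpace α] [MeasurableSpace β]
    [NormedAddCommGroup E] [NormedSpace ℝ E] [CompleteSpace E] (m : Measure α) [IsFiniteMeasure m]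
    (φ : SimpleFunc α β) (f : β → E) :
    ∫ x, f (φ x) ∂m = ∑ y ∈ φ.range, m.real (φ ⁻¹' {y}) • f y := by
  classical
  have hdecomp (x : α) : f (φ x) = ∑ y ∈ φ.range, (φ ⁻¹' {y}).indicator (fun _ ↦ f y) x := by
    simp [Set.indicator_apply]
  simp_rw [hdecomp]
  rw [integral_finsetSum _ fun y _ ↦
    (integrable_const _).indicator (φ.measurableSet_preimage {y})]
  exact Finset.sum_congr rfl fun y _ ↦
    integral_indicator_const _ (φ.measurableSet_preimage {y})

theorem exists_tendsto_sum_smul_integral {α : Type*} [PseudoEMetricSpace α]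
    [SecondCountableTopology α] [MeasurableSpace α] [OpensMeasurableSpace α] (m : Measure α)
    [IsProbabilityMeasure m] (E : Type*) [NormedAddCommGroup E] [NormedSpace ℝ E]
    [CompleteSpace E] :
    ∃ (s : ℕ → Finset α) (w : ℕ → α → ℝ), (∀ n x, 0 ≤ w n x) ∧ (∀ n, ∑ x ∈ s n, w n x = 1) ∧
      ∀ f : BoundedContinuousFunction α E,
        Tendsto (fun n ↦ ∑ x ∈ s n, w n x • f x) atTop (𝓝 (∫ x, f x ∂m)) := by
  obtain ⟨x₀⟩ : Nonempty α := nonempty_of_isProbabilityMeasure m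
  let φ : ℕ → SimpleFunc α α := SimpleFunc.approxOn id measurable_id Set.univ x₀ (Set.mem_univ x₀)
  have hφ (x : α) : Tendsto (fun n ↦ φ n x) atTop (𝓝 x) :=
    SimpleFunc.tendsto_approxOn measurable_id (Set.mem_univ x₀) (by simp)
  refine ⟨fun n ↦ (φ n).range, fun n y ↦ m.real (φ n ⁻¹' {y}), fun n y ↦ measureReal_nonneg,
    fun n ↦ ?_, fun f ↦ ?_⟩
  · simpa using (integral_simpleFunc_comp m (φ n) fun _ ↦ (1 : ℝ)).symm
  · simp only [← integral_simpleFunc_comp]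
    exact tendsto_integral_of_dominated_convergence (fun _ ↦ ‖f‖)
      (fun n ↦ ((φ n).map f).aestronglyMeasurable) (integrable_const _)
      (fun n ↦ .of_forall fun x ↦ f.norm_coe_le_norm _)
      (.of_forall fun x ↦ (f.continuous.tendsto x).comp (hφ x))

end FiniteSupport

section RankOne

variable {E : Type*} [NormedAddCommGroup E] [InnerProductSpace ℂ E] [FiniteDimensional ℂ E]
  {T : E →ₗ[ℂ] E} {v : E}

/-- `ρ` is the spectral measure of `T` in the state `v`, and `u` the resolvent `(z - T)⁻¹ v`. -/
theorem exists_cauchyTransform_eq_inner (hT : T.IsSymmetric) (hv : ‖v‖ = 1) :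
    ∃ ρ : ProbabilityMeasure ℝ, ∀ (z : ℂ) (u : E), z.im ≠ 0 → z • u - T u = v →
      cauchyTransform ρ z = inner ℂ v u := by
  let b := hT.eigenvectorBasis rfl
  let a := hT.eigenvalues rfl
  obtain ⟨ρ, hρ⟩ := exists_cauchyTransform_eq_sum (s := Finset.univ)
    (w := fun j ↦ ‖inner ℂ (b j) v‖ ^ 2) (fun j _ ↦ by positivity)
    (by rw [b.sum_sq_norm_inner_right, hv, one_pow]) fun j ↦ diracProba (a j)
  refine ⟨ρ, fun z u hz hu ↦ ?_⟩
  rw [hρ z hz, ← b.sum_inner_mul_inner v u]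
  refine Finset.sum_congr rfl fun j _ ↦ ?_
  have hcoord : inner ℂ (b j) v = (z - a j) * inner ℂ (b j) u := by
    rw [← hu, inner_sub_right, inner_smul_right, ← hT, hT.apply_eigenvectorBasis, inner_smul_left]
    simp [a, b, sub_mul]
  have hne := sub_ofReal_ne_zero hz (a j)
  rw [cauchyTransform_diracProba, ← inner_conj_symm v, Complex.ofReal_pow, ← Complex.conj_mul',
    mul_assoc]
  congr 1
  rw [hcoord]
  field_simp

/-- `σ` is the spectral measure of the rank-one perturbation `T + c ⟨v, ·⟩ v`. -/
theorem exists_cauchyTransform_eq_inv_inv_inner_sub (hT : T.IsSymmetric) (hv : ‖v‖ = 1) (c : ℝ) :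
    ∃ σ : ProbabilityMeasure ℝ, ∀ (z : ℂ) (u : E), 0 < z.im → z • u - T u = v →
      cauchyTransform σ z = ((inner ℂ v u)⁻¹ - c)⁻¹ := by
  obtain ⟨ρ, hρ⟩ := exists_cauchyTransform_eq_inner hT hv
  let S : E →ₗ[ℂ] E := T + (c : ℂ) • (innerₛₗ ℂ v).smulRight v
  have hS (u : E) : S u = T u + ((c : ℂ) * inner ℂ v u) • v := by
    simp [S, mul_smul]
  have hsymm : S.IsSymmetric := fun u u' ↦ by
    simp only [hS, inner_add_left, inner_add_right, hT u u', inner_smul_left, inner_smul_right,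
      map_mul, Complex.conj_ofReal, inner_conj_symm]
    ring
  obtain ⟨σ, hσ⟩ := exists_cauchyTransform_eq_inner hsymm hv
  refine ⟨σ, fun z u hz hu ↦ ?_⟩
  have hG := hρ z u hz.ne' hu
  have hg : inner ℂ v u ≠ 0 := hG ▸ cauchyTransform_ne_zero ρ hz
  have hH : (inner ℂ v u)⁻¹ - c ≠ 0 :=
    sub_ofReal_ne_zero (hG ▸ (recipCauchy_im_pos ρ hz).ne') c
  have hne : 1 - c * inner ℂ v u ≠ 0 := by
    intro h
    refine hH ?_
    field_simp
    linear_combination h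
  have hu' : z • ((1 - c * inner ℂ v u)⁻¹ • u) - S ((1 - c * inner ℂ v u)⁻¹ • u) = v := by
    rw [hS, map_smul, inner_smul_right, smul_comm, ← sub_sub, ← smul_sub, hu, ← sub_smul]
    convert one_smul ℂ v using 2
    field_simp
  rw [hσ z _ hz.ne' hu', inner_smul_right]
  field_simp

theorem exists_cauchyTransform_eq_inv_inv_sum_sub {s : Finset ℝ} {w : ℝ → ℝ}
    (hw : ∀ x ∈ s, 0 ≤ w x) (hsum : ∑ x ∈ s, w x = 1) (c : ℝ) :
    ∃ σ : ProbabilityMeasure ℝ, ∀ z : ℂ, 0 < z.im →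
      cauchyTransform σ z = ((∑ x ∈ s, w x * (z - x)⁻¹)⁻¹ - c)⁻¹ := by
  let v : EuclideanSpace ℂ s := WithLp.toLp 2 fun x ↦ (√(w x) : ℂ)
  let T : EuclideanSpace ℂ s →ₗ[ℂ] EuclideanSpace ℂ s :=
    Matrix.toEuclideanLin (Matrix.diagonal fun x : s ↦ ((x : ℝ) : ℂ))
  have hT : T.IsSymmetric := Matrix.isSymmetric_toEuclideanLin_iff.2
    (Matrix.isHermitian_diagonal_of_self_adjoint _ (by ext; simp))
  have hsqrt (x : s) : (√(w x) : ℂ) * √(w x) = w x := by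
    exact_mod_cast Real.mul_self_sqrt (hw x x.2)
  have hv : ‖v‖ = 1 := by
    have hsq (x : s) : ‖v x‖ ^ 2 = w x := by
      simp [v, Real.sq_sqrt (hw x x.2)]
    rw [EuclideanSpace.norm_eq, Finset.sum_congr rfl fun x _ ↦ hsq x, Finset.sum_coe_sort s w, hsum,
      Real.sqrt_one]
  obtain ⟨σ, hσ⟩ := exists_cauchyTransform_eq_inv_inv_inner_sub hT hv c
  refine ⟨σ, fun z hz ↦ ?_⟩
  let u : EuclideanSpace ℂ s := WithLp.toLp 2 fun x ↦ √(w x) * (z - (x : ℝ))⁻¹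
  have hu : z • u - T u = v := by
    ext x
    have hne := sub_ofReal_ne_zero hz.ne' x
    simp only [u, v, T, PiLp.sub_apply, PiLp.smul_apply, Matrix.toLpLin_apply,
      Matrix.mulVec_diagonal, smul_eq_mul]
    field_simp
  have hinner : inner ℂ v u = ∑ x ∈ s, w x * (z - x)⁻¹ := by
    rw [← Finset.sum_coe_sort s, PiLp.inner_apply]
    refine Finset.sum_congr rfl fun x _ ↦ ?_
    simp only [u, v, RCLike.inner_apply, Complex.conj_ofReal, ← hsqrt]
    ring
  rw [hσ z u hz hu, hinner]

end RankOne

section Existence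

variable {μ ν ρ : ProbabilityMeasure ℝ}

theorem isMonotoneConv_iff : IsMonotoneConv μ ν ρ ↔
    ∀ z : ℂ, 0 < z.im → cauchyTransform ρ z = cauchyTransform μ (recipCauchy ν z) := by
  refine ⟨fun h z hz ↦ inv_injective (h z hz.ne'), fun h z hz ↦ ?_⟩
  rcases hz.lt_or_gt with hz | hz
  · have hconj := congrArg (·⁻¹) (h (starRingEnd ℂ z) (by simpa using hz))
    change recipCauchy ρ _ = recipCauchy μ _ at hconj
    simpa only [recipCauchy_conj, (starRingEnd ℂ).injective.eq_iff] using hconj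
  · exact congrArg (·⁻¹) (h z hz)

theorem tendsto_im_recipCauchy_mul_I (ν : ProbabilityMeasure ℝ) :
    Tendsto (fun y : ℝ ↦ (recipCauchy ν (y * Complex.I)).im) atTop atTop := by
  refine tendsto_atTop_mono' _ ?_ tendsto_id
  filter_upwards [eventually_gt_atTop 0] with y hy
  simpa using im_le_im_recipCauchy ν (z := y * Complex.I) (by simpa using hy)

theorem eventually_norm_recipCauchy_mul_I_le (ν : ProbabilityMeasure ℝ) :
    ∀ᶠ y : ℝ in atTop,
      ‖recipCauchy ν (y * Complex.I)‖ ≤ 2 * (recipCauchy ν (y * Complex.I)).im := by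
  have hnorm := ((tendsto_mul_cauchyTransform_I ν).inv₀ one_ne_zero).norm
  rw [inv_one, norm_one] at hnorm
  filter_upwards [eventually_gt_atTop 0, hnorm.eventually_le_const one_lt_two] with y hy hle
  have him := im_le_im_recipCauchy ν (z := y * Complex.I) (by simpa using hy)
  rw [mul_inv, norm_mul, norm_inv, norm_mul, Complex.norm_I, Complex.norm_real,
    Real.norm_of_nonneg hy.le, mul_one, inv_mul_le_iff₀ hy, ← recipCauchy] at hle
  simp only [Complex.mul_I_im, Complex.ofReal_re] at him
  linarith

theorem exists_isMonotoneConv_of_tendsto {σ : ℕ → ProbabilityMeasure ℝ}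
    (h : ∀ z : ℂ, 0 < z.im → Tendsto (fun n ↦ cauchyTransform (σ n) z) atTop
      (𝓝 (cauchyTransform μ (recipCauchy ν z)))) :
    ∃ ρ, IsMonotoneConv μ ν ρ := by
  simp only [isMonotoneConv_iff]
  refine exists_cauchyTransform_eq_of_tendsto le_rfl h ?_
  have hlim := (tendsto_mul_cauchyTransform μ (tendsto_im_recipCauchy_mul_I ν)
    (eventually_norm_recipCauchy_mul_I_le ν)).mul (tendsto_mul_cauchyTransform_I ν)
  rw [one_mul] at hlim
  refine hlim.congr' ?_
  filter_upwards [eventually_gt_atTop 0] with y hy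
  have hne := cauchyTransform_ne_zero ν (z := y * Complex.I) (by simpa using hy)
  rw [recipCauchy]
  field_simp

theorem exists_isMonotoneConv_diracProba (c : ℝ) (ν : ProbabilityMeasure ℝ) :
    ∃ ρ, IsMonotoneConv (diracProba c) ν ρ := by
  obtain ⟨s, w, hw, hsum, hlim⟩ := exists_tendsto_sum_smul_integral (ν : Measure ℝ) ℂ
  choose σ hσ using fun n ↦
    exists_cauchyTransform_eq_inv_inv_sum_sub (fun x _ ↦ hw n x) (hsum n) c
  refine exists_isMonotoneConv_of_tendsto (σ := σ) fun z hz ↦ ?_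
  have hG : Tendsto (fun n ↦ ∑ x ∈ s n, w n x * (z - x)⁻¹) atTop (𝓝 (cauchyTransform ν z)) :=
    hlim (.ofNormedAddCommGroup _ (continuous_inv_sub_ofReal hz.ne') _
      (norm_inv_sub_ofReal_le hz.ne'))
  simp only [hσ _ z hz, cauchyTransform_diracProba]
  exact ((hG.inv₀ (cauchyTransform_ne_zero ν hz)).sub_const (c : ℂ)).inv₀
    (sub_ofReal_ne_zero (recipCauchy_im_pos ν hz).ne' c)

theorem exists_isMonotoneConv (μ ν : ProbabilityMeasure ℝ) : ∃ ρ, IsMonotoneConv μ ν ρ := by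
  obtain ⟨s, w, hw, hsum, hlim⟩ := exists_tendsto_sum_smul_integral (μ : Measure ℝ) ℂ
  choose κ hκ using fun c ↦ exists_isMonotoneConv_diracProba c ν
  choose σ hσ using fun n ↦ exists_cauchyTransform_eq_sum (fun x _ ↦ hw n x) (hsum n) κ
  refine exists_isMonotoneConv_of_tendsto (σ := σ) fun z hz ↦ ?_
  have hH := (recipCauchy_im_pos ν hz).ne'
  simp only [hσ _ z hz.ne', isMonotoneConv_iff.1 (hκ _) z hz, cauchyTransform_diracProba]
  exact hlim (.ofNormedAddCommGroup _ (continuous_inv_sub_ofReal hH) _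
    (norm_inv_sub_ofReal_le hH))

theorem existsUnique_isMonotoneConv (μ ν : ProbabilityMeasure ℝ) : ∃! ρ, IsMonotoneConv μ ν ρ :=
  existsUnique_of_exists_of_unique (exists_isMonotoneConv μ ν) fun _ _ h h' ↦
    eq_of_cauchyTransform_eq fun z hz ↦
      (isMonotoneConv_iff.1 h z hz).trans (isMonotoneConv_iff.1 h' z hz).symm

theorem isMonotoneConv_monotoneConv (μ ν : ProbabilityMeasure ℝ) :
    IsMonotoneConv μ ν (monotoneConv μ ν) :=
  Classical.epsilon_spec (exists_isMonotoneConv μ ν)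

theorem cauchyTransform_monotoneConvPow (μ : ProbabilityMeasure ℝ) (n : ℕ) {z : ℂ}
    (hz : 0 < z.im) :
    cauchyTransform (monotoneConvPow μ n) z = ((recipCauchy μ)^[n] z)⁻¹ := by
  induction n using Nat.twoStepInduction generalizing z with
  | zero => simp [monotoneConvPow, cauchyTransform]
  | one => simp [monotoneConvPow, inv_recipCauchy]
  | more n _ ih =>
    rw [monotoneConvPow, isMonotoneConv_iff.1 (isMonotoneConv_monotoneConv _ _) z hz,
      ih (recipCauchy_im_pos μ hz), Function.iterate_succ_apply _ (n + 1)]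

end Existence

section FiniteVariance

variable {ν : ProbabilityMeasure ℝ} {δ : ℝ} {w z : ℂ}

theorem sq_mul_cauchyTransform (hsq : Integrable (fun x ↦ x ^ 2) (ν : Measure ℝ))
    (hw : w.im ≠ 0) :
    w ^ 2 * cauchyTransform ν w
      = w + ((∫ x, x ∂(ν : Measure ℝ) : ℝ) + weightedCauchy ν (fun x ↦ x ^ 2) w) := by
  rw [sq, mul_assoc, mul_cauchyTransform ν hw, mul_add, mul_one,
    mul_weightedCauchy (by simpa using integrable_pow_of_le one_le_two hsq) hw]
  simp only [sq]

theorem recipCauchy_mul_add (hsq : Integrable (fun x ↦ x ^ 2) (ν : Measure ℝ)) (hw : 0 < w.im) :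
    recipCauchy ν w * (w + ((∫ x, x ∂(ν : Measure ℝ) : ℝ) + weightedCauchy ν (fun x ↦ x ^ 2) w))
      = w ^ 2 := by
  rw [← sq_mul_cauchyTransform hsq hw.ne', recipCauchy]
  have := cauchyTransform_ne_zero ν hw
  field_simp

theorem norm_weightedCauchy_sq_le (hsq : Integrable (fun x ↦ x ^ 2) (ν : Measure ℝ))
    (hδ : 0 < δ) (hw : δ ≤ w.im) :
    ‖weightedCauchy ν (fun x ↦ x ^ 2) w‖ ≤ (∫ x, x ^ 2 ∂(ν : Measure ℝ)) / δ := by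
  refine (norm_weightedCauchy_le hsq (hδ.trans_le hw).ne').trans ?_
  simp only [abs_sq, abs_of_pos (hδ.trans_le hw)]
  rw [div_eq_inv_mul]
  gcongr

theorem norm_sub_le_of_mul_add_eq_sq {h a : ℂ} (h_eq : h * (w + a) = w ^ 2) (hw : w ≠ 0)
    (ha : 2 * ‖a‖ ≤ ‖w‖) : ‖h - w‖ ≤ 2 * ‖a‖ := by
  have hw0 : 0 < ‖w‖ := norm_pos_iff.2 hw
  have hh : ‖h‖ ≤ 2 * ‖w‖ := by
    have hsum : ‖w‖ / 2 ≤ ‖w + a‖ := by linarith [norm_sub_le_norm_add w a]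
    have hnorm : ‖h‖ * ‖w + a‖ = ‖w‖ ^ 2 := by rw [← norm_mul, h_eq, norm_pow]
    nlinarith [norm_nonneg h]
  have hsub : (h - w) * w = -(a * h) := by linear_combination h_eq
  refine le_of_mul_le_mul_right ?_ hw0
  calc ‖h - w‖ * ‖w‖ = ‖a‖ * ‖h‖ := by rw [← norm_mul, hsub, norm_neg, norm_mul]
    _ ≤ ‖a‖ * (2 * ‖w‖) := by gcongr
    _ = 2 * ‖a‖ * ‖w‖ := by ring

theorem norm_sub_add_le_of_mul_add_eq_sq {h a w : ℂ} (h_eq : h * (w + a) = w ^ 2) (hw : 1 ≤ ‖w‖)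
    (ha : 2 * ‖a‖ ≤ ‖w‖) : ‖h - w + a‖ ≤ 2 * ‖a‖ ^ 2 := by
  have hle := norm_sub_le_of_mul_add_eq_sq h_eq (norm_pos_iff.1 (by linarith)) ha
  have hsub : (h - w + a) * w = -(a * (h - w)) := by linear_combination h_eq
  calc ‖h - w + a‖ ≤ ‖h - w + a‖ * ‖w‖ := le_mul_of_one_le_right (norm_nonneg _) hw
    _ = ‖a‖ * ‖h - w‖ := by rw [← norm_mul, hsub, norm_neg, norm_mul]
    _ ≤ ‖a‖ * (2 * ‖a‖) := by gcongr
    _ = 2 * ‖a‖ ^ 2 := by ring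

theorem norm_recipCauchy_sub_self_le (hsq : Integrable (fun x ↦ x ^ 2) (ν : Measure ℝ))
    (hmean : ∫ x, x ∂(ν : Measure ℝ) = 0) (hδ : 0 < δ)
    (hvar : ∫ x, x ^ 2 ∂(ν : Measure ℝ) ≤ δ ^ 2 / 2) (hw : δ ≤ w.im) :
    ‖recipCauchy ν w - w‖ ≤ 2 * (∫ x, x ^ 2 ∂(ν : Measure ℝ)) / δ := by
  have hH := recipCauchy_mul_add hsq (hδ.trans_le hw)
  rw [hmean, Complex.ofReal_zero, zero_add] at hH
  have hW := norm_weightedCauchy_sq_le hsq hδ hw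
  have hδw : δ ≤ ‖w‖ := hw.trans ((le_abs_self _).trans (Complex.abs_im_le_norm w))
  have hv : (∫ x, x ^ 2 ∂(ν : Measure ℝ)) / δ ≤ δ / 2 := (div_le_iff₀ hδ).2 (by linarith)
  calc _ ≤ 2 * ‖weightedCauchy ν (fun x ↦ x ^ 2) w‖ :=
        norm_sub_le_of_mul_add_eq_sq hH (norm_pos_iff.1 (hδ.trans_le hδw)) (by linarith)
    _ ≤ 2 * ((∫ x, x ^ 2 ∂(ν : Measure ℝ)) / δ) := by gcongr
    _ = 2 * (∫ x, x ^ 2 ∂(ν : Measure ℝ)) / δ := by ring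

/-- The map `w ↦ w ^ 2` conjugates `H_ν` to an approximate translation by `-2 Var(ν)`. -/
theorem norm_recipCauchy_sq_sub_sq_add_le (hsq : Integrable (fun x ↦ x ^ 2) (ν : Measure ℝ))
    (hmean : ∫ x, x ∂(ν : Measure ℝ) = 0) (hδ : 0 < δ)
    (hvar : ∫ x, x ^ 2 ∂(ν : Measure ℝ) ≤ δ ^ 2 / 2) (hw : δ ≤ w.im) :
    ‖recipCauchy ν w ^ 2 - w ^ 2 + 2 * (∫ x, x ^ 2 ∂(ν : Measure ℝ) : ℝ)‖
      ≤ 2 * ‖weightedCauchy ν (fun x ↦ x * x ^ 2) w‖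
        + 8 * ((∫ x, x ^ 2 ∂(ν : Measure ℝ)) / δ) ^ 2 := by
  have hexp := mul_weightedCauchy hsq (hδ.trans_le hw).ne'
  have hW := norm_weightedCauchy_sq_le hsq hδ hw
  have hH := recipCauchy_mul_add hsq (hδ.trans_le hw)
  rw [hmean, Complex.ofReal_zero, zero_add] at hH
  have hβ := norm_recipCauchy_sub_self_le hsq hmean hδ hvar hw
  set v := ∫ x, x ^ 2 ∂(ν : Measure ℝ)
  set W := weightedCauchy ν (fun x ↦ x ^ 2) w
  set R := weightedCauchy ν (fun x ↦ x * x ^ 2) w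
  set β := recipCauchy ν w - w with hβdef
  have hsplit : recipCauchy ν w ^ 2 - w ^ 2 + 2 * v = -2 * R - 2 * (W * β) + β ^ 2 := by
    rw [hβdef]
    linear_combination 2 * hH - 2 * hexp
  rw [mul_div_assoc] at hβ
  calc _ ≤ 2 * ‖R‖ + 2 * (‖W‖ * ‖β‖) + ‖β‖ ^ 2 := by
        rw [hsplit]
        refine (norm_add_le _ _).trans
          (add_le_add ((norm_sub_le _ _).trans_eq ?_) (norm_pow_le _ _))
        simp
    _ ≤ 2 * ‖R‖ + 2 * (v / δ * (2 * (v / δ))) + (2 * (v / δ)) ^ 2 := by gcongr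
    _ = 2 * ‖R‖ + 8 * (v / δ) ^ 2 := by ring

theorem norm_iterate_recipCauchy_sub_le (hsq : Integrable (fun x ↦ x ^ 2) (ν : Measure ℝ))
    (hmean : ∫ x, x ∂(ν : Measure ℝ) = 0) (hz : 0 < z.im)
    (hvar : ∫ x, x ^ 2 ∂(ν : Measure ℝ) ≤ z.im ^ 2 / 2) (n : ℕ) :
    ‖(recipCauchy ν)^[n] z - z‖ ≤ n * (2 * (∫ x, x ^ 2 ∂(ν : Measure ℝ)) / z.im) := by
  rw [← dist_eq_norm, dist_comm, ← smul_eq_mul, Nat.cast_smul_eq_nsmul]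
  refine (dist_le_range_sum_dist (fun k ↦ (recipCauchy ν)^[k] z) n).trans ?_
  refine (Finset.sum_le_card_nsmul _ _ _ fun k _ ↦ ?_).trans_eq (by rw [Finset.card_range])
  rw [dist_comm, dist_eq_norm, Function.iterate_succ_apply']
  exact norm_recipCauchy_sub_self_le hsq hmean hz hvar (im_le_im_iterate_recipCauchy ν k hz)

theorem norm_iterate_recipCauchy_sq_sub_sq_add_le
    (hsq : Integrable (fun x ↦ x ^ 2) (ν : Measure ℝ))
    (hmean : ∫ x, x ∂(ν : Measure ℝ) = 0) (hz : 0 < z.im)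
    (hvar : ∫ x, x ^ 2 ∂(ν : Measure ℝ) ≤ z.im ^ 2 / 2) {n : ℕ} {ε : ℝ}
    (hε : ∀ w : ℂ, z.im ≤ w.im →
      ‖w‖ ≤ ‖z‖ + n * (2 * (∫ x, x ^ 2 ∂(ν : Measure ℝ)) / z.im) →
        ‖weightedCauchy ν (fun x ↦ x * x ^ 2) w‖ ≤ ε) :
    ‖(recipCauchy ν)^[n] z ^ 2 - z ^ 2 + 2 * (n * ∫ x, x ^ 2 ∂(ν : Measure ℝ) : ℝ)‖
      ≤ n * (2 * ε + 8 * ((∫ x, x ^ 2 ∂(ν : Measure ℝ)) / z.im) ^ 2) := by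
  set v := ∫ x, x ^ 2 ∂(ν : Measure ℝ)
  have : 0 ≤ v := integral_nonneg fun x ↦ sq_nonneg x
  have htele : (recipCauchy ν)^[n] z ^ 2 - z ^ 2 + 2 * (n * v : ℝ)
      = ∑ k ∈ Finset.range n,
        ((recipCauchy ν)^[k + 1] z ^ 2 - (recipCauchy ν)^[k] z ^ 2 + 2 * v) := by
    rw [Finset.sum_add_distrib, Finset.sum_range_sub (fun k ↦ (recipCauchy ν)^[k] z ^ 2)]
    simp
    ring
  rw [htele]
  refine (norm_sum_le_of_le _ fun k hk ↦ ?_).trans_eq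
    (by rw [Finset.sum_const, Finset.card_range, nsmul_eq_mul])
  have him := im_le_im_iterate_recipCauchy ν k hz
  rw [Function.iterate_succ_apply']
  refine (norm_recipCauchy_sq_sub_sq_add_le hsq hmean hz hvar him).trans ?_
  gcongr
  refine hε _ him ?_
  have hk' : (k : ℝ) ≤ n := by exact_mod_cast (Finset.mem_range.1 hk).le
  calc ‖(recipCauchy ν)^[k] z‖ ≤ ‖z‖ + ‖(recipCauchy ν)^[k] z - z‖ := norm_le_norm_add_norm_sub' _ _
    _ ≤ ‖z‖ + k * (2 * v / z.im) := by
      gcongr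
      exact norm_iterate_recipCauchy_sub_le hsq hmean hz hvar k
    _ ≤ ‖z‖ + n * (2 * v / z.im) := by gcongr

end FiniteVariance

section Dilation

variable {μ : ProbabilityMeasure ℝ} {c δ T : ℝ}

theorem integral_dilation {E : Type*} [NormedAddCommGroup E] [NormedSpace ℝ E] (c : ℝ)
    (μ : ProbabilityMeasure ℝ) {f : ℝ → E}
    (hf : AEStronglyMeasurable f (dilation c μ : Measure ℝ)) :
    ∫ x, f x ∂(dilation c μ : Measure ℝ) = ∫ x, f (c * x) ∂(μ : Measure ℝ) :=
  integral_map (measurable_const_mul c).aemeasurable hf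

theorem integrable_sq_dilation (hsq : Integrable (fun x ↦ x ^ 2) (μ : Measure ℝ)) (c : ℝ) :
    Integrable (fun x ↦ x ^ 2) (dilation c μ : Measure ℝ) := by
  refine (integrable_map_measure (Measurable.aestronglyMeasurable (by fun_prop))
    (measurable_const_mul c).aemeasurable).2 ?_
  simpa [Function.comp_def, mul_pow] using hsq.const_mul (c ^ 2)

theorem norm_ofReal_mul_inv_sub_le (hδ : 0 < δ) {w : ℂ} (hw : δ ≤ w.im) (hT : ‖w‖ ≤ T) (x : ℝ) :
    ‖(x : ℂ) * (w - x)⁻¹‖ ≤ min (|x| / δ) (T / δ + 1) := by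
  have hw0 : w.im ≠ 0 := (hδ.trans_le hw).ne'
  have hinv : ‖(w - x)⁻¹‖ ≤ δ⁻¹ := (norm_inv_sub_ofReal_le hw0 x).trans
    (inv_anti₀ hδ (hw.trans (le_abs_self _)))
  refine le_min ?_ ?_
  · rw [norm_mul, Complex.norm_real, Real.norm_eq_abs, div_eq_mul_inv]
    gcongr
  · refine (norm_ofReal_mul_inv_sub_ofReal_le hw0 x).trans ?_
    rw [abs_of_pos (hδ.trans_le hw), ← div_eq_mul_inv]
    gcongr
    exact (norm_nonneg w).trans hT

theorem integrable_min_mul_sq (hsq : Integrable (fun x ↦ x ^ 2) (μ : Measure ℝ)) (c : ℝ)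
    (hδ : 0 ≤ δ) (hT : 0 ≤ T) :
    Integrable (fun x ↦ min (|c * x| / δ) (T / δ + 1) * x ^ 2) (μ : Measure ℝ) := by
  refine hsq.bdd_mul (c := T / δ + 1) (Measurable.aestronglyMeasurable (by fun_prop))
    (.of_forall fun x ↦ ?_)
  rw [Real.norm_of_nonneg (by positivity)]
  exact min_le_right _ _

theorem norm_weightedCauchy_dilation_le (hsq : Integrable (fun x ↦ x ^ 2) (μ : Measure ℝ))
    (hδ : 0 < δ) {w : ℂ} (hw : δ ≤ w.im) (hT : ‖w‖ ≤ T) :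
    ‖weightedCauchy (dilation c μ) (fun x ↦ x * x ^ 2) w‖
      ≤ c ^ 2 * ∫ x, min (|c * x| / δ) (T / δ + 1) * x ^ 2 ∂(μ : Measure ℝ) := by
  rw [weightedCauchy, integral_dilation, ← integral_const_mul]
  · refine norm_integral_le_of_norm_le
      ((integrable_min_mul_sq hsq c hδ.le ((norm_nonneg w).trans hT)).const_mul _)
      (.of_forall fun x ↦ ?_)
    calc ‖((c * x * (c * x) ^ 2 : ℝ) : ℂ) * (w - (c * x : ℝ))⁻¹‖
        = ‖((c * x : ℝ) : ℂ) * (w - (c * x : ℝ))⁻¹‖ * (c * x) ^ 2 := by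
          rw [Complex.ofReal_mul, mul_right_comm, norm_mul _ (((c * x) ^ 2 : ℝ) : ℂ),
            Complex.norm_real, Real.norm_of_nonneg (sq_nonneg (c * x))]
      _ ≤ min (|c * x| / δ) (T / δ + 1) * (c * x) ^ 2 := by
          gcongr
          exact norm_ofReal_mul_inv_sub_le hδ hw hT _
      _ = c ^ 2 * (min (|c * x| / δ) (T / δ + 1) * x ^ 2) := by ring
  · exact (Measurable.aestronglyMeasurable (by fun_prop)).mul
      (continuous_inv_sub_ofReal (hδ.trans_le hw).ne').aestronglyMeasurable

theorem tendsto_integral_min_mul_sq (hsq : Integrable (fun x ↦ x ^ 2) (μ : Measure ℝ))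
    (hδ : 0 < δ) (hT : 0 ≤ T) :
    Tendsto (fun c ↦ ∫ x, min (|c * x| / δ) (T / δ + 1) * x ^ 2 ∂(μ : Measure ℝ)) (𝓝 0) (𝓝 0) := by
  refine (tendsto_integral_filter_of_dominated_convergence (f := fun _ ↦ 0)
    (fun x ↦ (T / δ + 1) * x ^ 2)
    (.of_forall fun c ↦ (integrable_min_mul_sq hsq c hδ.le hT).aestronglyMeasurable)
    (.of_forall fun c ↦ .of_forall fun x ↦ ?_) (hsq.const_mul _) (.of_forall fun x ↦ ?_)).trans
    (by rw [integral_zero])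
  · rw [Real.norm_of_nonneg (by positivity)]
    gcongr
    exact min_le_right _ _
  · have hcont : Continuous fun c : ℝ ↦ min (|c * x| / δ) (T / δ + 1) * x ^ 2 := by fun_prop
    have hzero : min (|0 * x| / δ) (T / δ + 1) * x ^ 2 = 0 := by
      rw [zero_mul, abs_zero, zero_div, min_eq_left (by positivity), zero_mul]
    simpa only [hzero] using hcont.tendsto 0

theorem tendsto_iterate_recipCauchy_dilation_sq
    (hsq : Integrable (fun x ↦ x ^ 2) (μ : Measure ℝ)) (hmean : ∫ x, x ∂(μ : Measure ℝ) = 0)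
    (hvar : ∫ x, x ^ 2 ∂(μ : Measure ℝ) = 1) {z : ℂ} (hz : 0 < z.im) :
    Tendsto (fun N : ℕ ↦ (recipCauchy (dilation (1 / √N) μ))^[N] z ^ 2) atTop
      (𝓝 (z ^ 2 - 2)) := by
  let T := ‖z‖ + 2 / z.im
  let ε (c : ℝ) := ∫ x, min (|c * x| / z.im) (T / z.im + 1) * x ^ 2 ∂(μ : Measure ℝ)
  have hscale : Tendsto (fun N : ℕ ↦ 1 / √N) atTop (𝓝 0) :=
    tendsto_const_nhds.div_atTop (Real.tendsto_sqrt_atTop.comp tendsto_natCast_atTop_atTop)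
  have hbound : Tendsto (fun N : ℕ ↦ 2 * ε (1 / √N) + 8 / z.im ^ 2 * (1 / √N) ^ 2) atTop (𝓝 0) := by
    have hε : Tendsto (fun N : ℕ ↦ ε (1 / √N)) atTop (𝓝 0) :=
      (tendsto_integral_min_mul_sq hsq hz (by positivity)).comp hscale
    simpa only [ne_eq, OfNat.ofNat_ne_zero, not_false_eq_true, zero_pow, mul_zero, add_zero] using
      (hε.const_mul 2).add ((hscale.pow 2).const_mul (8 / z.im ^ 2))
  have hsmall : ∀ᶠ N : ℕ in atTop, (1 / √N) ^ 2 ≤ z.im ^ 2 / 2 :=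
    (hscale.pow 2).eventually_le_const (by rw [zero_pow two_ne_zero]; positivity)
  rw [tendsto_iff_norm_sub_tendsto_zero]
  refine squeeze_zero' (.of_forall fun _ ↦ norm_nonneg _) ?_ hbound
  filter_upwards [hsmall, eventually_gt_atTop 0] with N hN hN0
  have hNc : N * (1 / √N) ^ 2 = (1 : ℝ) := by
    rw [div_pow, Real.sq_sqrt N.cast_nonneg]
    field_simp
  set c := 1 / √(N : ℝ)
  have hmeanc : ∫ x, x ∂(dilation c μ : Measure ℝ) = 0 := by
    rw [integral_dilation c μ (f := fun x ↦ x) aestronglyMeasurable_id, integral_const_mul, hmean,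
      mul_zero]
  have hvarc : ∫ x, x ^ 2 ∂(dilation c μ : Measure ℝ) = c ^ 2 := by
    rw [integral_dilation c μ (Measurable.aestronglyMeasurable (by fun_prop))]
    simp only [mul_pow, integral_const_mul, hvar, mul_one]
  have hmain := norm_iterate_recipCauchy_sq_sub_sq_add_le (integrable_sq_dilation hsq c) hmeanc hz
    (hvarc.trans_le hN) (n := N) (ε := c ^ 2 * ε c) fun w hw hwT ↦
      norm_weightedCauchy_dilation_le hsq hz hw (hwT.trans_eq ?_)
  · rw [hvarc, hNc] at hmain
    calc _ = _ := by congr 1; push_cast; ring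
      _ ≤ _ := hmain
      _ = 2 * ε c * (N * c ^ 2) + 8 / z.im ^ 2 * c ^ 2 * (N * c ^ 2) := by ring
      _ = _ := by rw [hNc]; ring
  · rw [hvarc]
    linear_combination 2 / z.im * hNc

end Dilation

section Arcsine

variable {z : ℂ}

theorem integral_arcsineMeasure (f : ℝ → ℂ) :
    ∫ x, f x ∂arcsineMeasure = ∫ x in Set.Ioo (-√2) √2, (arcsineDensity x : ℂ) * f x := by
  rw [arcsineMeasure, integral_withDensity_eq_integral_toReal_smul
    (by unfold arcsineDensity; fun_prop) (.of_forall fun _ ↦ by simp)]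
  simp only [ENNReal.toReal_ofReal (arcsineDensity_nonneg _), Complex.real_smul]

theorem integrable_arcsineMeasure_iff (f : ℝ → ℂ) : Integrable f arcsineMeasure ↔
    IntegrableOn (fun x ↦ (arcsineDensity x : ℂ) * f x) (Set.Ioo (-√2) √2) := by
  rw [arcsineMeasure, integrable_withDensity_iff_integrable_smul'
    (by unfold arcsineDensity; fun_prop) (.of_forall fun _ ↦ by simp)]
  simp only [IntegrableOn, ENNReal.toReal_ofReal (arcsineDensity_nonneg _), Complex.real_smul]

theorem two_sub_sq_pos {x : ℝ} (hx : x ∈ Set.Ioo (-√2) √2) : 0 < 2 - x ^ 2 := by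
  have := sq_lt_sq' hx.1 hx.2
  rw [Real.sq_sqrt zero_le_two] at this
  linarith

theorem hasDerivAt_sqrt_two_sub_sq {x : ℝ} (hx : x ∈ Set.Ioo (-√2) √2) :
    HasDerivAt (fun x ↦ √(2 - x ^ 2) / Real.pi) (-x * arcsineDensity x) x := by
  have hpos := two_sub_sq_pos hx
  refine ((((hasDerivAt_id x).pow 2).const_sub 2).sqrt hpos.ne' |>.div_const Real.pi).congr_deriv ?_
  have hsqrt : √(2 - x ^ 2) ≠ 0 := (Real.sqrt_pos.2 hpos).ne'
  simp only [arcsineDensity, id, Pi.pow_apply]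
  field_simp
  ring

theorem sqrt_two_sub_sq_eq {x : ℝ} (hx : x ∈ Set.Ioo (-√2) √2) :
    √(2 - x ^ 2) / Real.pi = (2 - x ^ 2) * arcsineDensity x := by
  rw [arcsineDensity]
  have := Real.sqrt_pos.2 (two_sub_sq_pos hx)
  have := Real.sq_sqrt (two_sub_sq_pos hx).le
  field_simp
  assumption

theorem hasDerivAt_sqrt_mul_inv_sub (hz : z.im ≠ 0) {x : ℝ} (hx : x ∈ Set.Ioo (-√2) √2) :
    HasDerivAt (fun x : ℝ ↦ ((√(2 - x ^ 2) / Real.pi : ℝ) : ℂ) * (z - x)⁻¹)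
      ((arcsineDensity x : ℂ) * ((2 - z * x) * ((z - x) ^ 2)⁻¹)) x := by
  have hne := sub_ofReal_ne_zero hz x
  have hinv : HasDerivAt (fun x : ℝ ↦ (z - x)⁻¹) ((z - x) ^ 2)⁻¹ x := by
    simpa [div_eq_mul_inv] using ((hasDerivAt_id x).ofReal_comp.const_sub z).fun_inv hne
  refine ((hasDerivAt_sqrt_two_sub_sq hx).ofReal_comp.mul hinv).congr_deriv ?_
  rw [sqrt_two_sub_sq_eq hx]
  push_cast
  field_simp
  ring

theorem integrable_inv_sub_ofReal_sq {m : Measure ℝ} [IsFiniteMeasure m] (hz : z.im ≠ 0) :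
    Integrable (fun x : ℝ ↦ ((z - x) ^ 2)⁻¹) m := by
  refine .of_bound (C := |z.im|⁻¹ ^ 2) ?_ (.of_forall fun x ↦ ?_)
  · simp_rw [← inv_pow]
    exact ((continuous_inv_sub_ofReal hz).pow 2).aestronglyMeasurable
  · rw [← inv_pow, norm_pow]
    gcongr
    exact norm_inv_sub_ofReal_le hz x

theorem integral_arcsineMeasure_eq_zero (hz : z.im ≠ 0)
    (hint : Integrable (fun x : ℝ ↦ (2 - z * x) * ((z - x) ^ 2)⁻¹) arcsineMeasure) :
    ∫ x : ℝ, (2 - z * x) * ((z - x) ^ 2)⁻¹ ∂arcsineMeasure = 0 := by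
  have hle : -√2 ≤ √2 := by linarith [Real.sqrt_nonneg 2]
  have hcont : Continuous fun x : ℝ ↦ ((√(2 - x ^ 2) / Real.pi : ℝ) : ℂ) * (z - x)⁻¹ :=
    Continuous.mul (by fun_prop) (continuous_inv_sub_ofReal hz)
  rw [integrable_arcsineMeasure_iff] at hint
  rw [integral_arcsineMeasure, ← integral_Ioc_eq_integral_Ioo,
    ← intervalIntegral.integral_of_le hle,
    intervalIntegral.integral_eq_sub_of_hasDerivAt_of_le hle hcont.continuousOn
      (fun x hx ↦ hasDerivAt_sqrt_mul_inv_sub hz hx)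
      ((intervalIntegrable_iff_integrableOn_Ioo_of_le hle).2 hint)]
  simp

theorem deriv_cauchyTransform_arcsineLaw (hz : 0 < z.im) :
    (z ^ 2 - 2) * deriv (cauchyTransform arcsineLaw) z = -(z * cauchyTransform arcsineLaw z) := by
  have hinv := (integrable_inv_sub_ofReal (m := arcsineMeasure) hz.ne').const_mul z
  have hinvSq : Integrable (fun x : ℝ ↦ (z ^ 2 - 2) * -((z - x) ^ 2)⁻¹) arcsineMeasure :=
    (integrable_inv_sub_ofReal_sq hz.ne').neg.const_mul _
  have hsplit (x : ℝ) : (z ^ 2 - 2) * -((z - x) ^ 2)⁻¹ + z * (z - x)⁻¹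
      = (2 - z * x) * ((z - x) ^ 2)⁻¹ := by
    have := sub_ofReal_ne_zero hz.ne' x
    field_simp
    ring
  have hzero := integral_arcsineMeasure_eq_zero hz.ne' ((hinvSq.add hinv).congr (.of_forall hsplit))
  simp only [← hsplit] at hzero
  rw [integral_add hinvSq hinv, integral_const_mul, integral_const_mul] at hzero
  rw [(hasDerivAt_cauchyTransform arcsineLaw hz).deriv]
  exact eq_neg_of_add_eq_zero_left hzero

theorem cauchyTransform_arcsineLaw_sq (hz : 0 < z.im) :
    cauchyTransform arcsineLaw z ^ 2 * (z ^ 2 - 2) = 1 := by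
  let F (w : ℂ) := cauchyTransform arcsineLaw w ^ 2 * (w ^ 2 - 2)
  have hderiv {w : ℂ} (hw : 0 < w.im) : HasDerivAt F 0 w := by
    have hG := (hasDerivAt_cauchyTransform arcsineLaw hw).differentiableAt.hasDerivAt
    refine ((hG.pow 2).mul (((hasDerivAt_id w).pow 2).sub_const 2)).congr_deriv ?_
    simp only [Pi.pow_apply, id]
    push_cast
    linear_combination 2 * cauchyTransform arcsineLaw w * deriv_cauchyTransform_arcsineLaw hw
  have hconst {w : ℂ} (hw : 0 < w.im) : F w = F z :=
    (isOpen_lt continuous_const Complex.continuous_im).is_const_of_deriv_eq_zero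
      (convex_halfSpace_im_gt 0).isPreconnected
      (fun w hw ↦ (hderiv hw).differentiableAt.differentiableWithinAt)
      (fun w hw ↦ (hderiv hw).deriv) hw hz
  have hinv : Tendsto (fun y : ℝ ↦ ((y⁻¹ : ℝ) : ℂ)) atTop (𝓝 ((0 : ℝ) : ℂ)) :=
    (Complex.continuous_ofReal.tendsto 0).comp tendsto_inv_atTop_zero
  have hlim := ((tendsto_mul_cauchyTransform_I arcsineLaw).pow 2).mul
    (((hinv.pow 2).const_mul 2).const_add 1)
  norm_num at hlim
  refine tendsto_nhds_unique (tendsto_const_nhds.congr' ?_) hlim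
  filter_upwards [eventually_gt_atTop 0] with y hy
  have hy' : (y : ℂ) ≠ 0 := by exact_mod_cast hy.ne'
  refine (hconst (w := y * Complex.I) (by simpa using hy)).symm.trans ?_
  simp only [F, mul_pow, Complex.I_sq]
  field_simp
  ring

end Arcsine

theorem tendsto_of_tendsto_sq {ι : Type*} {l : Filter ι} {w : ι → ℂ} {a : ℂ}
    (ha : 0 < a.im) (hw : ∀ i, 0 < (w i).im) (h : Tendsto (fun i ↦ w i ^ 2) l (𝓝 (a ^ 2))) :
    Tendsto w l (𝓝 a) := by
  rw [tendsto_iff_norm_sub_tendsto_zero] at h ⊢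
  refine squeeze_zero (fun _ ↦ norm_nonneg _) (fun i ↦ ?_)
    ((h.mul_const a.im⁻¹).trans_eq (by rw [zero_mul]))
  have hsum : a.im ≤ ‖w i + a‖ := by
    have := (le_abs_self _).trans (Complex.abs_im_le_norm (w i + a))
    rw [Complex.add_im] at this
    linarith [hw i]
  rw [← div_eq_mul_inv, le_div_iff₀ ha]
  calc ‖w i - a‖ * a.im ≤ ‖w i - a‖ * ‖w i + a‖ := by gcongr
    _ = ‖w i ^ 2 - a ^ 2‖ := by rw [← norm_mul]; ring_nf

theorem tendsto_monotoneConvPow_arcsineLaw {μ : ProbabilityMeasure ℝ}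
    (hmean : ∫ x, x ∂(μ : Measure ℝ) = 0) (hvar : variance (fun x ↦ x) (μ : Measure ℝ) = 1) :
    Tendsto (fun N : ℕ ↦ monotoneConvPow (dilation (1 / √N) μ) N) atTop (𝓝 arcsineLaw) := by
  have hmeas : AEMeasurable (fun x : ℝ ↦ x) (μ : Measure ℝ) := aemeasurable_id
  rw [variance_of_integral_eq_zero hmeas hmean] at hvar
  have hsq : Integrable (fun x ↦ x ^ 2) (μ : Measure ℝ) :=
    .of_integral_ne_zero (hvar.trans_ne one_ne_zero)
  refine tendsto_of_tendsto_cauchyTransform le_rfl fun z hz ↦ ?_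
  have hG := cauchyTransform_ne_zero arcsineLaw hz
  have hH : recipCauchy arcsineLaw z ^ 2 = z ^ 2 - 2 := by
    rw [recipCauchy]
    field_simp
    linear_combination -cauchyTransform_arcsineLaw_sq hz
  simp_rw [cauchyTransform_monotoneConvPow _ _ hz, ← inv_recipCauchy]
  refine Tendsto.inv₀ (tendsto_of_tendsto_sq (recipCauchy_im_pos _ hz)
    (fun N ↦ hz.trans_le (im_le_im_iterate_recipCauchy _ N hz)) ?_) (inv_ne_zero hG)
  rw [hH]
  exact tendsto_iterate_recipCauchy_dilation_sq hsq hmean hvar hz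

/-- The Laurent series `∑ m n / z ^ (n + 1)` at infinity with coefficients `m`. It is the formal
Cauchy transform of a measure with moments `m`. -/
noncomputable def momentSeries (m : ℕ → ℝ) (z : ℂ) : ℂ :=
  ∑' n, (m n : ℂ) * z⁻¹ ^ (n + 1)

section MomentSeries

variable {m : ℕ → ℝ} {A C : ℝ} {z : ℂ}

theorem norm_ofReal_mul_inv_pow_le (hC : 0 < C) (hz : 2 * C ≤ ‖z‖) {a : ℝ} {n : ℕ}
    (ha : |a| ≤ A * C ^ n) : ‖(a : ℂ) * z⁻¹ ^ n‖ ≤ A * (1 / 2) ^ n := by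
  rw [norm_mul, Complex.norm_real, Real.norm_eq_abs, norm_pow, norm_inv]
  have hzC : C * ‖z‖⁻¹ ≤ 1 / 2 := by
    rw [← div_eq_mul_inv, div_le_iff₀ (by linarith)]
    linarith
  have hA : 0 ≤ A := nonneg_of_mul_nonneg_left ((abs_nonneg a).trans ha) (by positivity)
  calc |a| * ‖z‖⁻¹ ^ n ≤ A * C ^ n * ‖z‖⁻¹ ^ n := by gcongr
    _ = A * (C * ‖z‖⁻¹) ^ n := by ring
    _ ≤ A * (1 / 2) ^ n := by gcongr

theorem norm_momentSeries_term_le (hC : 0 < C) (hz : 2 * C ≤ ‖z‖) {a : ℝ} {n : ℕ}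
    (ha : |a| ≤ A * C ^ n) : ‖(a : ℂ) * z⁻¹ ^ (n + 1)‖ ≤ A * (1 / 2) ^ n * ‖z‖⁻¹ := by
  rw [pow_succ, ← mul_assoc, norm_mul _ z⁻¹, norm_inv]
  gcongr
  exact norm_ofReal_mul_inv_pow_le hC hz ha

theorem hasSum_geometric_bound (A : ℝ) (z : ℂ) :
    HasSum (fun n : ℕ ↦ A * (1 / 2 : ℝ) ^ n * ‖z‖⁻¹) (A * 2 * ‖z‖⁻¹) :=
  (hasSum_geometric_two.mul_left A).mul_right _

theorem summable_momentSeries (hC : 0 < C) (hm : ∀ n, |m n| ≤ A * C ^ n) (hz : 2 * C ≤ ‖z‖) :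
    Summable fun n ↦ (m n : ℂ) * z⁻¹ ^ (n + 1) :=
  .of_norm_bounded (hasSum_geometric_bound A z).summable
    fun n ↦ norm_momentSeries_term_le hC hz (hm n)

theorem norm_momentSeries_le (hC : 0 < C) (hm : ∀ n, |m n| ≤ A * C ^ n) (hz : 2 * C ≤ ‖z‖) :
    ‖momentSeries m z‖ ≤ A * 2 * ‖z‖⁻¹ :=
  tsum_of_norm_bounded (hasSum_geometric_bound A z)
    fun n ↦ norm_momentSeries_term_le hC hz (hm n)

theorem mul_momentSeries (hC : 0 < C) (hm : ∀ n, |m n| ≤ A * C ^ n) (hz : 2 * C ≤ ‖z‖) :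
    z * momentSeries m z = m 0 + momentSeries (fun n ↦ m (n + 1)) z := by
  have hz0 : z ≠ 0 := norm_pos_iff.1 (by linarith)
  rw [momentSeries, (summable_momentSeries hC hm hz).tsum_eq_zero_add, mul_add, momentSeries,
    ← tsum_mul_left]
  congr 1
  · rw [zero_add, pow_one]
    field_simp
  · refine tsum_congr fun n ↦ ?_
    rw [pow_succ _ (n + 1)]
    field_simp

theorem abs_shift_le (hm : ∀ n, |m n| ≤ A * C ^ n) (k n : ℕ) :
    |m (n + k)| ≤ A * C ^ k * C ^ n := by
  rw [mul_assoc, ← pow_add, add_comm k]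
  exact hm _

theorem norm_momentSeries_mul_I_le (hC : 0 < C) (hm : ∀ n, |m n| ≤ A * C ^ n) {y : ℝ}
    (hy : 2 * C ≤ y) : ‖momentSeries m (y * Complex.I)‖ ≤ A * 2 * y⁻¹ := by
  have hnorm : ‖(y * Complex.I : ℂ)‖ = y := by simp [abs_of_pos (by linarith : 0 < y)]
  simpa only [hnorm] using norm_momentSeries_le hC hm (hy.trans_eq hnorm.symm)

theorem tendsto_momentSeries_mul_I (hC : 0 < C) (hm : ∀ n, |m n| ≤ A * C ^ n) :
    Tendsto (fun y : ℝ ↦ momentSeries m (y * Complex.I)) atTop (𝓝 0) := by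
  refine squeeze_zero_norm' (a := fun y : ℝ ↦ A * 2 * y⁻¹) ?_
    (by simpa using tendsto_inv_atTop_zero.const_mul (A * 2))
  filter_upwards [eventually_ge_atTop (2 * C)] with y hy using norm_momentSeries_mul_I_le hC hm hy

theorem mul_momentSeries_mul_I (hC : 0 < C) (hm : ∀ n, |m n| ≤ A * C ^ n) {y : ℝ}
    (hy : 2 * C ≤ y) : y * Complex.I * momentSeries m (y * Complex.I)
      = m 0 + momentSeries (fun n ↦ m (n + 1)) (y * Complex.I) :=
  mul_momentSeries hC hm (hy.trans (by simpa using le_abs_self y))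

theorem tendsto_mul_momentSeries_mul_I (hC : 0 < C) (hm : ∀ n, |m n| ≤ A * C ^ n) :
    Tendsto (fun y : ℝ ↦ y * Complex.I * momentSeries m (y * Complex.I)) atTop (𝓝 (m 0)) := by
  have := (tendsto_momentSeries_mul_I hC (abs_shift_le hm 1)).const_add (m 0 : ℂ)
  rw [add_zero] at this
  refine this.congr' ?_
  filter_upwards [eventually_ge_atTop (2 * C)] with y hy
  exact (mul_momentSeries_mul_I hC hm hy).symm

end MomentSeries

section HamburgerNevanlinna

variable {μ : Measure ℝ} {f : ℝ → ℝ} {m : ℕ → ℝ} {A C : ℝ}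

theorem integral_eq_of_weightedCauchy_eq (hf : Integrable f μ) (hC : 0 < C)
    (hm : ∀ n, |m n| ≤ A * C ^ n)
    (h : ∀ᶠ y : ℝ in atTop, weightedCauchy μ f (y * Complex.I) = momentSeries m (y * Complex.I)) :
    ∫ x, f x ∂μ = m 0 := by
  have hleft : Tendsto (fun y : ℝ ↦ y * Complex.I * weightedCauchy μ f (y * Complex.I)) atTop
      (𝓝 (∫ x, f x ∂μ : ℝ)) := by
    have := (tendsto_weightedCauchy_id_mul_I hf).const_add ((∫ x, f x ∂μ : ℝ) : ℂ)
    rw [add_zero] at this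
    refine this.congr' ?_
    filter_upwards [eventually_gt_atTop 0] with y hy
    exact (mul_weightedCauchy hf (by simpa using hy.ne')).symm
  exact_mod_cast tendsto_nhds_unique (hleft.congr' (h.mono fun y hy ↦ by rw [hy]))
    (tendsto_mul_momentSeries_mul_I hC hm)

theorem weightedCauchy_id_mul_eq (hf : Integrable f μ) (hC : 0 < C)
    (hm : ∀ n, |m n| ≤ A * C ^ n)
    (h : ∀ᶠ y : ℝ in atTop, weightedCauchy μ f (y * Complex.I) = momentSeries m (y * Complex.I)) :
    ∀ᶠ y : ℝ in atTop, weightedCauchy μ (fun x ↦ x * f x) (y * Complex.I)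
      = momentSeries (fun n ↦ m (n + 1)) (y * Complex.I) := by
  filter_upwards [h, eventually_ge_atTop (2 * C)] with y hy hyC
  have hy0 : y ≠ 0 := by linarith
  have := mul_weightedCauchy hf (z := y * Complex.I) (by simpa using hy0)
  rw [hy, mul_momentSeries_mul_I hC hm hyC, integral_eq_of_weightedCauchy_eq hf hC hm h] at this
  exact (add_left_cancel this).symm

theorem integral_sq_div_sq_add_sq_mul_le (hf : Integrable f μ) (hC : 0 < C)
    (hm : ∀ n, |m n| ≤ A * C ^ n)
    (h : ∀ᶠ y : ℝ in atTop, weightedCauchy μ f (y * Complex.I) = momentSeries m (y * Complex.I)) :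
    ∀ᶠ y : ℝ in atTop, y ^ 2 * ∫ x, x ^ 2 / (x ^ 2 + y ^ 2) * f x ∂μ ≤ A * C ^ 2 * 2 := by
  filter_upwards [h, eventually_ge_atTop (2 * C)] with y hy hyC
  have hy0 : 0 < y := by linarith
  set S₁ := momentSeries (fun n ↦ m (n + 1)) (y * Complex.I)
  set S₂ := momentSeries (fun n ↦ m (n + 1 + 1)) (y * Complex.I)
  have hS₁ : y * Complex.I * S₁ = m 1 + S₂ :=
    mul_momentSeries_mul_I hC (abs_shift_le hm 1) hyC
  have hS₂ : ‖S₂‖ ≤ A * C ^ 2 * 2 * y⁻¹ :=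
    norm_momentSeries_mul_I_le hC (fun n ↦ abs_shift_le hm 2 n) hyC
  have hre : y * S₁.re = S₂.im := by simpa using congrArg Complex.im hS₁
  rw [← integral_sub_re_mul_weightedCauchy_mul_I hf hy0.ne', hy, mul_momentSeries_mul_I hC hm hyC,
    integral_eq_of_weightedCauchy_eq hf hC hm h, Complex.add_re, Complex.ofReal_re,
    sub_add_cancel_left]
  calc y ^ 2 * -S₁.re = y * -S₂.im := by rw [← hre]; ring
    _ ≤ y * (A * C ^ 2 * 2 * y⁻¹) := by
      gcongr
      exact (neg_le_abs _).trans ((Complex.abs_im_le_norm _).trans hS₂)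
    _ = A * C ^ 2 * 2 := by field_simp

theorem tendsto_sq_mul_sq_div_sq_add_sq (x : ℝ) :
    Tendsto (fun y : ℝ ↦ y ^ 2 * (x ^ 2 / (x ^ 2 + y ^ 2))) atTop (𝓝 (x ^ 2)) := by
  have hlim : Tendsto (fun y : ℝ ↦ x ^ 2 / (x ^ 2 * y⁻¹ ^ 2 + 1)) atTop (𝓝 (x ^ 2 / (0 + 1))) := by
    refine .div tendsto_const_nhds (.add_const 1 ?_) (by norm_num)
    simpa using (tendsto_inv_atTop_zero.pow 2).const_mul (x ^ 2)
  rw [zero_add, div_one] at hlim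
  refine hlim.congr' ?_
  filter_upwards [eventually_gt_atTop 0] with y hy
  field_simp

theorem integrable_sq_mul_of_weightedCauchy_eq (hf : Integrable f μ) (hf0 : 0 ≤ f) (hC : 0 < C)
    (hm : ∀ n, |m n| ≤ A * C ^ n)
    (h : ∀ᶠ y : ℝ in atTop, weightedCauchy μ f (y * Complex.I) = momentSeries m (y * Complex.I)) :
    Integrable (fun x ↦ x ^ 2 * f x) μ := by
  let g (n : ℕ) (x : ℝ) : ℝ := (n : ℝ) ^ 2 * (x ^ 2 / (x ^ 2 + (n : ℝ) ^ 2) * f x)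
  have hg0 (n : ℕ) (x : ℝ) : 0 ≤ g n x := by
    have : 0 ≤ f x := hf0 x
    positivity
  have hgi (n : ℕ) : Integrable (g n) μ := (integrable_sq_div_sq_add_sq_mul hf n).const_mul _
  refine integrable_of_tendsto (G := g) (.of_forall fun x ↦ ?_)
    (fun n ↦ (hgi n).aestronglyMeasurable) (ne_top_of_le_ne_top ENNReal.ofReal_ne_top
      (liminf_le_of_frequently_le' (x := ENNReal.ofReal (A * C ^ 2 * 2))
        (Eventually.frequently ?_)))
  · refine (((tendsto_sq_mul_sq_div_sq_add_sq x).comp tendsto_natCast_atTop_atTop).mul_const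
      (f x)).congr fun n ↦ ?_
    simp [g, mul_assoc]
  · filter_upwards [tendsto_natCast_atTop_atTop.eventually
      (integral_sq_div_sq_add_sq_mul_le hf hC hm h)] with n hn
    rw [← ofReal_integral_norm_eq_lintegral_enorm (hgi n)]
    simp only [Real.norm_of_nonneg (hg0 n _), g, integral_const_mul]
    exact ENNReal.ofReal_le_ofReal hn

theorem weightedCauchy_pow_eq (hC : 0 < C) (hm : ∀ n, |m n| ≤ A * C ^ n)
    (h : ∀ᶠ y : ℝ in atTop,
      weightedCauchy μ (fun _ ↦ 1) (y * Complex.I) = momentSeries m (y * Complex.I))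
    {n : ℕ} (hint : ∀ k < n, Integrable (fun x ↦ x ^ k) μ) :
    ∀ᶠ y : ℝ in atTop, weightedCauchy μ (fun x ↦ x ^ n) (y * Complex.I)
      = momentSeries (fun k ↦ m (k + n)) (y * Complex.I) := by
  induction n with
  | zero => simpa using h
  | succ n ih =>
    simpa only [← pow_succ', add_right_comm _ 1 n, add_assoc] using
      weightedCauchy_id_mul_eq (hint n n.lt_succ_self) hC (abs_shift_le hm n)
        (ih fun k hk ↦ hint k (hk.trans n.lt_succ_self))

theorem integrable_pow_of_weightedCauchy_eq [IsFiniteMeasure μ] (hC : 0 < C)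
    (hm : ∀ n, |m n| ≤ A * C ^ n)
    (h : ∀ᶠ y : ℝ in atTop,
      weightedCauchy μ (fun _ ↦ 1) (y * Complex.I) = momentSeries m (y * Complex.I)) (n : ℕ) :
    Integrable (fun x ↦ x ^ n) μ := by
  suffices heven : Integrable (fun x ↦ x ^ (2 * n)) μ from integrable_pow_of_le (by omega) heven
  induction n with
  | zero => simp
  | succ n ih =>
    have hW := weightedCauchy_pow_eq hC hm h (n := 2 * n)
      fun k hk ↦ integrable_pow_of_le hk.le ih
    simpa only [← pow_add, add_comm 2, mul_add_one] using integrable_sq_mul_of_weightedCauchy_eq ih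
      (fun x ↦ (even_two_mul n).pow_nonneg x) hC (abs_shift_le hm (2 * n)) hW

/-- The Hamburger–Nevanlinna theorem, for expansions at infinity that converge. -/
theorem hasAllMoments_of_cauchyTransform_eq {μ : ProbabilityMeasure ℝ} (hC : 0 < C)
    (hm : ∀ n, |m n| ≤ A * C ^ n)
    (h : ∀ᶠ y : ℝ in atTop,
      cauchyTransform μ (y * Complex.I) = momentSeries m (y * Complex.I)) :
    HasAllMoments μ ∧ moment μ = m := by
  simp only [cauchyTransform_eq_weightedCauchy] at h
  have hint := integrable_pow_of_weightedCauchy_eq hC hm h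
  refine ⟨hint, funext fun n ↦ ?_⟩
  simpa [moment] using integral_eq_of_weightedCauchy_eq (hint n) hC (abs_shift_le hm n)
    (weightedCauchy_pow_eq hC hm h fun k _ ↦ hint k)

theorem cauchyTransform_eq_sum_add {μ : ProbabilityMeasure ℝ} (hμ : HasAllMoments μ) {z : ℂ}
    (hz : z.im ≠ 0) (n : ℕ) : cauchyTransform μ z
      = ∑ k ∈ Finset.range n, (moment μ k : ℂ) * z⁻¹ ^ (k + 1)
        + z⁻¹ ^ n * weightedCauchy μ (fun x ↦ x ^ n) z := by
  induction n with
  | zero => simp [cauchyTransform_eq_weightedCauchy]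
  | succ n ih =>
    have hz0 : z ≠ 0 := fun h ↦ hz (by simp [h])
    have hstep : z * weightedCauchy μ (fun x ↦ x ^ n) z
        = moment μ n + weightedCauchy μ (fun x ↦ x ^ (n + 1)) z := by
      simpa only [← pow_succ', moment] using mul_weightedCauchy (hμ n) hz
    rw [ih, Finset.sum_range_succ, (eq_inv_mul_iff_mul_eq₀ hz0).2 hstep]
    ring

theorem cauchyTransform_eq_momentSeries {μ : ProbabilityMeasure ℝ} (hμ : HasAllMoments μ)
    (hC : 0 < C) (hm : ∀ n, |moment μ n| ≤ A * C ^ n) {z : ℂ} (hz : 2 * C ≤ z.im) :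
    cauchyTransform μ z = momentSeries (moment μ) z := by
  have hz0 : 0 < z.im := by linarith
  have hzn : 2 * C ≤ ‖z‖ := hz.trans ((le_abs_self _).trans (Complex.abs_im_le_norm z))
  have htwo : Tendsto (fun n ↦ 2 * n) atTop atTop := tendsto_id.const_mul_atTop' two_pos
  have hrem : Tendsto (fun n ↦ z⁻¹ ^ (2 * n) * weightedCauchy μ (fun x ↦ x ^ (2 * n)) z)
      atTop (𝓝 0) := by
    have hgeom : Tendsto (fun n ↦ A * (1 / 2) ^ (2 * n) * z.im⁻¹) atTop (𝓝 0) := by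
      simpa using (((tendsto_pow_atTop_nhds_zero_of_lt_one (r := (1 / 2 : ℝ)) (by norm_num)
        (by norm_num)).comp htwo).const_mul A).mul_const z.im⁻¹
    refine squeeze_zero_norm (fun n ↦ ?_) hgeom
    have hW : ‖weightedCauchy μ (fun x ↦ x ^ (2 * n)) z‖ ≤ |moment μ (2 * n)| * z.im⁻¹ := by
      have heven (x : ℝ) : |x ^ (2 * n)| = x ^ (2 * n) :=
        abs_of_nonneg ((even_two_mul n).pow_nonneg x)
      have := norm_weightedCauchy_le (hμ (2 * n)) hz0.ne'
      simp only [heven, abs_of_pos hz0] at this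
      exact this.trans (by rw [mul_comm]; gcongr; exact le_abs_self _)
    calc _ ≤ ‖z⁻¹ ^ (2 * n)‖ * (|moment μ (2 * n)| * z.im⁻¹) := by rw [norm_mul]; gcongr
      _ = ‖(moment μ (2 * n) : ℂ) * z⁻¹ ^ (2 * n)‖ * z.im⁻¹ := by
        rw [norm_mul, Complex.norm_real, Real.norm_eq_abs]
        ring
      _ ≤ A * (1 / 2) ^ (2 * n) * z.im⁻¹ := by
        gcongr
        exact norm_ofReal_mul_inv_pow_le hC hzn (hm _)
  have hlim := ((summable_momentSeries hC hm hzn).hasSum.tendsto_sum_nat.comp htwo).add hrem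
  rw [add_zero] at hlim
  exact tendsto_nhds_unique (tendsto_const_nhds.congr fun n ↦
    cauchyTransform_eq_sum_add hμ hz0.ne' (2 * n)) hlim

end HamburgerNevanlinna

section PoissonPolynomial

/-- The sums `∑ i₀ i₁ ⋯ i_{k-1}` over the chains `1 = i₀ < i₁ < ⋯ < i_{k-1} ≤ n` that occur in the
monotone Poisson moments, defined by splitting off the chains that end in `n`. The value at
`n = k = 0` is the coefficient of the moment of order `0`. -/
def chainSum : ℕ → ℕ → ℕ
  | 0, 0 => 1
  | 0, _ + 1 => 0
  | _ + 1, 0 => 0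
  | n + 1, k + 1 => chainSum n (k + 1) + (n + 1) * chainSum n k

variable {n k : ℕ}

theorem chainSum_succ_succ (n k : ℕ) :
    chainSum (n + 1) (k + 1) = chainSum n (k + 1) + (n + 1) * chainSum n k := rfl

theorem chainSum_zero_right (hn : n ≠ 0) : chainSum n 0 = 0 := by
  cases n with
  | zero => exact absurd rfl hn
  | succ n => rfl

theorem chainSum_le (n k : ℕ) : chainSum n k ≤ n.choose k * n ^ k := by
  induction n generalizing k with
  | zero => cases k <;> simp [chainSum]
  | succ n ih =>
    cases k with
    | zero => simp [chainSum]
    | succ k =>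
      calc chainSum n (k + 1) + (n + 1) * chainSum n k
          ≤ n.choose (k + 1) * (n + 1) ^ (k + 1) + (n + 1) * (n.choose k * (n + 1) ^ k) := by
            gcongr
            · exact (ih _).trans (by gcongr; omega)
            · exact (ih _).trans (by gcongr; omega)
        _ = (n + 1).choose (k + 1) * (n + 1) ^ (k + 1) := by
            rw [Nat.choose_succ_succ']
            ring

theorem chainSum_eq_zero (h : n < k) : chainSum n k = 0 := by
  simpa [Nat.choose_eq_zero_of_lt h] using chainSum_le n k

theorem sum_prod_powersetCard_insert {s : Finset ℕ} {a : ℕ} (ha : a ∉ s) (hone : a ≠ 1) (k : ℕ) :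
    ∑ t ∈ (Finset.powersetCard (k + 1) (insert a s)).filter (1 ∈ ·), ∏ i ∈ t, i
      = ∑ t ∈ (Finset.powersetCard (k + 1) s).filter (1 ∈ ·), ∏ i ∈ t, i
        + a * ∑ t ∈ (Finset.powersetCard k s).filter (1 ∈ ·), ∏ i ∈ t, i := by
  have hmem {j : ℕ} {t : Finset ℕ} (ht : t ∈ Finset.powersetCard j s) : a ∉ t :=
    fun h ↦ ha ((Finset.mem_powersetCard.1 ht).1 h)
  simp only [Finset.sum_filter]
  rw [Finset.powersetCard_succ_insert ha, Finset.sum_union, Finset.sum_image, Finset.mul_sum]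
  · congr 1
    refine Finset.sum_congr rfl fun t ht ↦ ?_
    simp [Finset.prod_insert (hmem ht), hone.symm]
  · intro t ht u hu htu
    rw [← Finset.erase_insert (hmem ht), ← Finset.erase_insert (hmem hu), htu]
  · refine Finset.disjoint_left.2 fun t ht ht' ↦ ?_
    obtain ⟨u, -, rfl⟩ := Finset.mem_image.1 ht'
    exact hmem ht (Finset.mem_insert_self _ _)

theorem chainSum_eq_sum (hn : 1 ≤ n) (k : ℕ) :
    chainSum n k
      = ∑ s ∈ (Finset.powersetCard k (Finset.Icc 1 n)).filter (1 ∈ ·), ∏ i ∈ s, i := by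
  induction n, hn using Nat.le_induction generalizing k with
  | base =>
    match k with
    | 0 => simp [chainSum, Finset.filter_singleton]
    | 1 => simp [chainSum, Finset.powersetCard_one, Finset.filter_singleton]
    | k + 2 => simp [chainSum_eq_zero (show 1 < k + 2 by omega), Finset.powersetCard_eq_empty.2]
  | succ n hn ih =>
    cases k with
    | zero => simp [chainSum, Finset.filter_singleton]
    | succ k =>
      rw [chainSum_succ_succ, ih, ih, ← Finset.insert_Icc_right_eq_Icc_add_one (by omega),
        sum_prod_powersetCard_insert (by simp) (by omega)]

/-- The monotone Poisson moment of order `n` as a polynomial in the parameter. -/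
noncomputable def poissonPoly (n : ℕ) : Polynomial ℝ :=
  ∑ k ∈ Finset.range (n + 1), Polynomial.monomial k ((chainSum n k : ℝ) / k.factorial)

theorem coeff_poissonPoly (n k : ℕ) :
    (poissonPoly n).coeff k = (chainSum n k : ℝ) / k.factorial := by
  simp only [poissonPoly, Polynomial.finsetSum_coeff, Polynomial.coeff_monomial, Finset.sum_ite_eq']
  split_ifs with hk
  · rfl
  · simp [chainSum_eq_zero (show n < k by simpa using hk)]

theorem poissonPoly_zero : poissonPoly 0 = 1 := by
  simp [poissonPoly, chainSum]

theorem eval_poissonPoly (n : ℕ) (t : ℝ) : (poissonPoly n).eval t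
    = ∑ k ∈ Finset.range (n + 1), t ^ k / k.factorial * chainSum n k := by
  simp only [poissonPoly, Polynomial.eval_finsetSum, Polynomial.eval_monomial]
  exact Finset.sum_congr rfl fun k _ ↦ by ring

theorem eval_zero_poissonPoly (hn : n ≠ 0) : (poissonPoly n).eval 0 = 0 := by
  rw [← Polynomial.coeff_zero_eq_eval_zero, coeff_poissonPoly, chainSum_zero_right hn]
  simp

theorem eval_poissonPoly_eq_monotonePoissonMoment (hn : 1 ≤ n) (t : ℝ) :
    (poissonPoly n).eval t = monotonePoissonMoment t n := by
  rw [eval_poissonPoly, Finset.range_eq_Ico, Finset.sum_eq_sum_Ico_succ_bot n.succ_pos,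
    chainSum_zero_right (by omega), monotonePoissonMoment]
  simp [chainSum_eq_sum hn, Finset.Ico_add_one_right_eq_Icc]

theorem derivative_poissonPoly_succ (n : ℕ) :
    (poissonPoly (n + 1)).derivative = (poissonPoly n).derivative + (n + 1) * poissonPoly n := by
  ext k
  have hk : (k.factorial : ℝ) ≠ 0 := by positivity
  rw [Polynomial.coeff_add, ← Nat.cast_succ, Polynomial.coeff_natCast_mul]
  simp only [Polynomial.coeff_derivative, coeff_poissonPoly, chainSum_succ_succ, Nat.factorial_succ]
  push_cast
  field_simp

variable {T t : ℝ}

theorem abs_eval_poissonPoly_le (ht : |t| ≤ T) (n : ℕ) :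
    |(poissonPoly n).eval t| ≤ (2 * Real.exp T) ^ n := by
  have hT : 0 ≤ T := (abs_nonneg t).trans ht
  have hterm (k : ℕ) : |t ^ k / k.factorial * chainSum n k| ≤ n.choose k * Real.exp T ^ n := by
    have hchain : (chainSum n k : ℝ) ≤ n.choose k * (n : ℝ) ^ k := mod_cast chainSum_le n k
    calc |t ^ k / k.factorial * chainSum n k| = |t| ^ k / k.factorial * chainSum n k := by
          simp [abs_mul, abs_div]
      _ ≤ T ^ k / k.factorial * (n.choose k * (n : ℝ) ^ k) := by gcongr
      _ = n.choose k * ((n * T) ^ k / k.factorial) := by ring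
      _ ≤ n.choose k * Real.exp T ^ n := by
        rw [← Real.exp_nat_mul]
        gcongr
        exact Real.pow_div_factorial_le_exp _ (by positivity) _
  calc |(poissonPoly n).eval t| ≤ ∑ k ∈ Finset.range (n + 1), n.choose k * Real.exp T ^ n := by
        rw [eval_poissonPoly]
        exact (Finset.abs_sum_le_sum_abs _ _).trans (Finset.sum_le_sum fun k _ ↦ hterm k)
    _ = (2 * Real.exp T) ^ n := by
        have hchoose : ∑ k ∈ Finset.range (n + 1), (n.choose k : ℝ) = 2 ^ n :=
          mod_cast Nat.sum_range_choose n
        rw [← Finset.sum_mul, hchoose, mul_pow]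

theorem abs_succ_mul_eval_poissonPoly_le (ht : |t| ≤ T) (n : ℕ) :
    |(n + 1) * (poissonPoly n).eval t| ≤ (4 * Real.exp T) ^ n := by
  have hn : (n : ℝ) + 1 ≤ 2 ^ n := mod_cast n.lt_two_pow_self
  calc |(n + 1) * (poissonPoly n).eval t| = (n + 1) * |(poissonPoly n).eval t| := by
        rw [abs_mul, abs_of_nonneg (by positivity)]
    _ ≤ 2 ^ n * (2 * Real.exp T) ^ n := by
        gcongr
        exact abs_eval_poissonPoly_le ht n
    _ = (4 * Real.exp T) ^ n := by
        rw [← mul_pow]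
        ring

theorem abs_eval_derivative_poissonPoly_le (ht : |t| ≤ T) (n : ℕ) :
    |(poissonPoly n).derivative.eval t| ≤ (4 * Real.exp T) ^ n := by
  have hexp : 1 ≤ Real.exp T := Real.one_le_exp ((abs_nonneg t).trans ht)
  induction n with
  | zero => simp [poissonPoly_zero]
  | succ n ih =>
    calc |(poissonPoly (n + 1)).derivative.eval t|
        = |(poissonPoly n).derivative.eval t + (n + 1) * (poissonPoly n).eval t| := by
          simp [derivative_poissonPoly_succ]
      _ ≤ (4 * Real.exp T) ^ n + (4 * Real.exp T) ^ n :=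
          (abs_add_le _ _).trans (add_le_add ih (abs_succ_mul_eval_poissonPoly_le ht n))
      _ = 2 * (4 * Real.exp T) ^ n := by ring
      _ ≤ 4 * Real.exp T * (4 * Real.exp T) ^ n := by
          gcongr
          linarith
      _ = (4 * Real.exp T) ^ (n + 1) := by ring

end PoissonPolynomial

section Transport

/-- The vector field `V` generating the monotone Poisson semigroup. If the moments of `μ` of order
`1, …, 4` are close to `c / N`, then `H_μ(w) - w` is close to `(c / N) V(w)`. -/
noncomputable def poissonField (w : ℂ) : ℂ := -w / (w - 1)

/-- The formal Cauchy transform of the monotone Poisson distribution with parameter `t`. As a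
function of `t` it solves the transport equation `∂ₜ Q = V ∂_z Q`, where `V` is `poissonField`. -/
noncomputable def poissonSeries (t : ℝ) (z : ℂ) : ℂ :=
  momentSeries (fun n ↦ (poissonPoly n).eval t) z

/-- The termwise derivative of `poissonSeries t` with respect to `z`. -/
noncomputable def poissonSeriesDeriv (t : ℝ) (z : ℂ) : ℂ :=
  -(z⁻¹ * momentSeries (fun n ↦ (n + 1) * (poissonPoly n).eval t) z)

theorem poissonField_eq {w : ℂ} (hw : w ≠ 1) : poissonField w = -(1 + (w - 1)⁻¹) := by
  have : w - 1 ≠ 0 := sub_ne_zero.2 hw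
  rw [poissonField]
  field_simp
  ring

theorem norm_inv_sub_one_le {w : ℂ} (hw : 1 ≤ w.im) : ‖(w - 1)⁻¹‖ ≤ 1 := by
  rw [norm_inv]
  refine inv_le_one_of_one_le₀ (hw.trans ?_)
  simpa using (le_abs_self _).trans (Complex.abs_im_le_norm (w - 1))

theorem ne_one_of_one_le_im {w : ℂ} (hw : 1 ≤ w.im) : w ≠ 1 := by
  rintro rfl
  norm_num at hw

theorem norm_poissonField_le {w : ℂ} (hw : 1 ≤ w.im) : ‖poissonField w‖ ≤ 2 := by
  rw [poissonField_eq (ne_one_of_one_le_im hw), norm_neg]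
  calc ‖1 + (w - 1)⁻¹‖ ≤ ‖(1 : ℂ)‖ + ‖(w - 1)⁻¹‖ := norm_add_le _ _
    _ ≤ 2 := by linarith [norm_inv_sub_one_le hw, norm_one (α := ℂ)]

theorem norm_poissonField_sub_le {w z : ℂ} (hw : 1 ≤ w.im) (hz : 1 ≤ z.im) :
    ‖poissonField w - poissonField z‖ ≤ ‖w - z‖ := by
  have hw1 : w - 1 ≠ 0 := sub_ne_zero.2 (ne_one_of_one_le_im hw)
  have hz1 : z - 1 ≠ 0 := sub_ne_zero.2 (ne_one_of_one_le_im hz)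
  have hsub : poissonField w - poissonField z = (w - z) * ((w - 1)⁻¹ * (z - 1)⁻¹) := by
    rw [poissonField, poissonField]
    field_simp
    ring
  rw [hsub, norm_mul, norm_mul]
  exact mul_le_of_le_one_right (norm_nonneg _) <|
    mul_le_one₀ (norm_inv_sub_one_le hw) (norm_nonneg _) (norm_inv_sub_one_le hz)

theorem poissonSeries_zero (z : ℂ) : poissonSeries 0 z = z⁻¹ := by
  rw [poissonSeries, momentSeries, tsum_eq_single 0]
  · simp [poissonPoly_zero]
  · intro n hn
    simp [eval_zero_poissonPoly hn]

variable {T t s : ℝ} {z w w' : ℂ}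

theorem summable_poissonSeries (ht : |t| ≤ T) (hz : 8 * Real.exp T ≤ ‖z‖) :
    Summable fun n ↦ (((poissonPoly n).eval t : ℝ) : ℂ) * z⁻¹ ^ (n + 1) :=
  summable_momentSeries (m := fun n ↦ (poissonPoly n).eval t) (A := 1) (C := 2 * Real.exp T)
    (by positivity) (by simpa using abs_eval_poissonPoly_le ht) (by linarith [Real.exp_pos T])

theorem norm_poissonSeries_term_le (hT : 0 ≤ T) (hz : 8 * Real.exp T ≤ ‖z‖) {a : ℝ} {n : ℕ}
    (ha : |a| ≤ (4 * Real.exp T) ^ n) : ‖(a : ℂ) * z⁻¹ ^ (n + 1)‖ ≤ (1 / 2) ^ n := by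
  have hz1 : 1 ≤ ‖z‖ := by linarith [Real.one_le_exp hT]
  calc ‖(a : ℂ) * z⁻¹ ^ (n + 1)‖ ≤ 1 * (1 / 2) ^ n * ‖z‖⁻¹ :=
        norm_momentSeries_term_le (C := 4 * Real.exp T) (by positivity) (by linarith)
          (by rwa [one_mul])
    _ ≤ 1 * (1 / 2) ^ n * 1 := by
        gcongr
        exact inv_le_one_of_one_le₀ hz1
    _ = (1 / 2) ^ n := by ring

theorem norm_poissonSeriesDeriv_le (ht : |t| ≤ T) (hz : 8 * Real.exp T ≤ ‖z‖) :
    ‖poissonSeriesDeriv t z‖ ≤ 2 := by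
  have hz1 : 1 ≤ ‖z‖ := by linarith [Real.one_le_exp ((abs_nonneg t).trans ht)]
  have hinv : ‖z‖⁻¹ ≤ 1 := inv_le_one_of_one_le₀ hz1
  have hbound := norm_momentSeries_le (m := fun n ↦ (n + 1) * (poissonPoly n).eval t) (A := 1)
    (C := 4 * Real.exp T) (by positivity)
    (by simpa only [one_mul] using abs_succ_mul_eval_poissonPoly_le ht) (z := z) (by linarith)
  rw [poissonSeriesDeriv, norm_neg, norm_mul, norm_inv]
  calc _ ≤ ‖z‖⁻¹ * (1 * 2 * ‖z‖⁻¹) := by gcongr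
    _ ≤ 1 * (1 * 2 * 1) := by gcongr
    _ = 2 := by norm_num

theorem momentSeries_derivative_poissonPoly (ht : |t| ≤ T) (hz : 8 * Real.exp T ≤ ‖z‖) :
    momentSeries (fun n ↦ (poissonPoly n).derivative.eval t) z
      = poissonField z * poissonSeriesDeriv t z := by
  have hexp : 1 ≤ Real.exp T := Real.one_le_exp ((abs_nonneg t).trans ht)
  have hC : 0 < 4 * Real.exp T := by positivity
  have hCz : 2 * (4 * Real.exp T) ≤ ‖z‖ := by linarith
  have hD : ∀ n, |(poissonPoly n).derivative.eval t| ≤ 1 * (4 * Real.exp T) ^ n := by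
    simpa using abs_eval_derivative_poissonPoly_le ht
  have hE : ∀ n : ℕ, |(n + 1) * (poissonPoly n).eval t| ≤ 1 * (4 * Real.exp T) ^ n := by
    simpa only [one_mul] using abs_succ_mul_eval_poissonPoly_le ht
  have hz0 : z ≠ 0 := norm_pos_iff.1 (by linarith)
  have hz1 : z - 1 ≠ 0 := by
    rw [sub_ne_zero]
    rintro rfl
    rw [norm_one] at hz
    linarith
  have hrec : z * momentSeries (fun n ↦ (poissonPoly n).derivative.eval t) z
      = momentSeries (fun n ↦ (poissonPoly n).derivative.eval t) z
        + momentSeries (fun n ↦ (n + 1) * (poissonPoly n).eval t) z := by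
    rw [mul_momentSeries hC hD hCz]
    simp only [momentSeries]
    rw [← (summable_momentSeries hC hD hCz).tsum_add (summable_momentSeries hC hE hCz)]
    simp [poissonPoly_zero, derivative_poissonPoly_succ, add_mul]
  rw [poissonField, poissonSeriesDeriv]
  field_simp
  linear_combination hrec

theorem hasDerivAt_eval_mul_inv_pow (p : Polynomial ℝ) (n : ℕ) {r : ℝ → ℝ} {ζ : ℝ → ℂ} {r' σ : ℝ}
    {ζ' : ℂ} (hr : HasDerivAt r r' σ) (hζ : HasDerivAt ζ ζ' σ) (hne : ζ σ ≠ 0) :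
    HasDerivAt (fun σ ↦ ((p.eval (r σ) : ℝ) : ℂ) * (ζ σ)⁻¹ ^ (n + 1))
      (r' * (((p.derivative.eval (r σ) : ℝ) : ℂ) * (ζ σ)⁻¹ ^ (n + 1))
        - ζ' * (ζ σ)⁻¹ * ((((n + 1) * p.eval (r σ) : ℝ) : ℂ) * (ζ σ)⁻¹ ^ (n + 1))) σ := by
  have hp : HasDerivAt (fun σ ↦ ((p.eval (r σ) : ℝ) : ℂ)) (p.derivative.eval (r σ) * r' : ℝ) σ :=
    ((p.hasDerivAt (r σ)).comp σ hr).ofReal_comp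
  refine (hp.mul ((hζ.fun_inv hne).fun_pow (n + 1))).congr_deriv ?_
  push_cast
  rw [div_eq_mul_inv, ← inv_pow]
  ring

theorem norm_deriv_poissonSeries_term_le (ht : |t| ≤ T) (hz : 8 * Real.exp T ≤ ‖z‖) (a : ℝ) (b : ℂ)
    (n : ℕ) :
    ‖a * (((poissonPoly n).derivative.eval t : ℝ) * z⁻¹ ^ (n + 1))
        - b * z⁻¹ * (((n + 1) * (poissonPoly n).eval t : ℝ) * z⁻¹ ^ (n + 1))‖
      ≤ (|a| + ‖b‖) * (1 / 2) ^ n := by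
  have hT : 0 ≤ T := (abs_nonneg t).trans ht
  have hinv : ‖z⁻¹‖ ≤ 1 := by
    rw [norm_inv]
    exact inv_le_one_of_one_le₀ (by linarith [Real.one_le_exp hT])
  refine (norm_sub_le _ _).trans ?_
  rw [norm_mul, norm_mul (b * z⁻¹), norm_mul b, Complex.norm_real, Real.norm_eq_abs, add_mul |a|]
  have hD := norm_poissonSeries_term_le hT hz (abs_eval_derivative_poissonPoly_le ht n)
  have hE := norm_poissonSeries_term_le hT hz (abs_succ_mul_eval_poissonPoly_le ht n)
  gcongr
  exact mul_le_of_le_one_right (norm_nonneg _) hinv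

theorem tsum_deriv_poissonSeries_term (ht : |t| ≤ T) (hz : 8 * Real.exp T ≤ ‖z‖) (a : ℝ) (b : ℂ) :
    ∑' n : ℕ, (a * (((poissonPoly n).derivative.eval t : ℝ) * z⁻¹ ^ (n + 1))
        - b * z⁻¹ * (((n + 1) * (poissonPoly n).eval t : ℝ) * z⁻¹ ^ (n + 1)))
      = (b + a * poissonField z) * poissonSeriesDeriv t z := by
  have hT : 0 ≤ T := (abs_nonneg t).trans ht
  have hD : Summable fun n ↦ (((poissonPoly n).derivative.eval t : ℝ) : ℂ) * z⁻¹ ^ (n + 1) :=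
    .of_norm_bounded summable_geometric_two fun n ↦
      norm_poissonSeries_term_le hT hz (abs_eval_derivative_poissonPoly_le ht n)
  have hE : Summable fun n : ℕ ↦
      (((n + 1) * (poissonPoly n).eval t : ℝ) : ℂ) * z⁻¹ ^ (n + 1) :=
    .of_norm_bounded summable_geometric_two fun n ↦
      norm_poissonSeries_term_le hT hz (abs_succ_mul_eval_poissonPoly_le ht n)
  rw [(hD.mul_left _).tsum_sub (hE.mul_left _), tsum_mul_left, tsum_mul_left, ← momentSeries,
    momentSeries_derivative_poissonPoly ht hz, poissonSeriesDeriv, momentSeries]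
  ring

theorem hasDerivAt_poissonSeries_lineMap {τ : ℝ} (hτ : AffineMap.lineMap t s τ ∈ Set.Ioo (-T) T)
    (hτ' : 8 * Real.exp T < (AffineMap.lineMap w w' τ : ℂ).im) :
    HasDerivAt (fun σ : ℝ ↦ poissonSeries (AffineMap.lineMap t s σ) (AffineMap.lineMap w w' σ))
      ((w' - w - (t - s) * poissonField (AffineMap.lineMap w w' τ))
        * poissonSeriesDeriv (AffineMap.lineMap t s τ) (AffineMap.lineMap w w' τ)) τ := by
  set r : ℝ →ᵃ[ℝ] ℝ := AffineMap.lineMap t s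
  set ζ : ℝ →ᵃ[ℝ] ℂ := AffineMap.lineMap w w'
  set S : Set ℝ := r ⁻¹' Set.Ioo (-T) T ∩ ζ ⁻¹' {z | 8 * Real.exp T < z.im}
  have hSo : IsOpen S := (isOpen_Ioo.preimage AffineMap.lineMap_continuous).inter
    ((isOpen_lt continuous_const Complex.continuous_im).preimage AffineMap.lineMap_continuous)
  have hSc : Convex ℝ S := ((convex_Ioo (-T) T).affine_preimage r).inter
    ((convex_halfSpace_im_gt _).affine_preimage ζ)
  have habs {σ : ℝ} (hσ : σ ∈ S) : |r σ| ≤ T := (abs_lt.2 hσ.1).le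
  have hnorm {σ : ℝ} (hσ : σ ∈ S) : 8 * Real.exp T ≤ ‖ζ σ‖ :=
    (le_of_lt hσ.2).trans ((le_abs_self _).trans (Complex.abs_im_le_norm _))
  have hne {σ : ℝ} (hσ : σ ∈ S) : ζ σ ≠ 0 :=
    norm_pos_iff.1 ((by positivity : 0 < 8 * Real.exp T).trans_le (hnorm hσ))
  have hmem : τ ∈ S := ⟨hτ, hτ'⟩
  refine (hasDerivAt_tsum_of_isPreconnected (summable_geometric_two.mul_left _) hSo
    hSc.isPreconnected (fun n σ hσ ↦ hasDerivAt_eval_mul_inv_pow _ n AffineMap.hasDerivAt_lineMap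
      AffineMap.hasDerivAt_lineMap (hne hσ))
    (fun n σ hσ ↦ norm_deriv_poissonSeries_term_le (habs hσ) (hnorm hσ) _ _ n) hmem
    (summable_poissonSeries (habs hmem) (hnorm hmem)) hmem).congr_deriv ?_
  rw [tsum_deriv_poissonSeries_term (habs hmem) (hnorm hmem)]
  push_cast
  ring

theorem norm_sub_sub_mul_poissonField_lineMap_le (hw : 1 ≤ w.im) (hw' : 1 ≤ w'.im) {τ : ℝ}
    (hτ : τ ∈ Set.Icc (0 : ℝ) 1) (a : ℝ) :
    ‖w' - w - a * poissonField (AffineMap.lineMap w w' τ)‖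
      ≤ ‖w' - w - a * poissonField w‖ + |a| * ‖w' - w‖ := by
  have hζ : 1 ≤ (AffineMap.lineMap w w' τ : ℂ).im :=
    (convex_halfSpace_im_ge _).lineMap_mem hw hw' hτ
  set ζ : ℂ := AffineMap.lineMap w w' τ with hζ_def
  have hζw : ‖ζ - w‖ ≤ ‖w' - w‖ := by
    rw [hζ_def, AffineMap.lineMap_apply, vsub_eq_sub, vadd_eq_add, add_sub_cancel_right, norm_smul,
      Real.norm_of_nonneg hτ.1]
    exact mul_le_of_le_one_left (norm_nonneg _) hτ.2
  calc ‖w' - w - a * poissonField ζ‖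
      = ‖w' - w - a * poissonField w - a * (poissonField ζ - poissonField w)‖ := by ring_nf
    _ ≤ ‖w' - w - a * poissonField w‖ + |a| * ‖poissonField ζ - poissonField w‖ := by
        refine (norm_sub_le _ _).trans_eq ?_
        rw [norm_mul (a : ℂ), Complex.norm_real, Real.norm_eq_abs]
    _ ≤ ‖w' - w - a * poissonField w‖ + |a| * ‖w' - w‖ := by
        gcongr
        exact (norm_poissonField_sub_le hζ hw).trans hζw

theorem norm_poissonSeries_sub_le (ht : |t| < T) (hs : |s| < T) (hw : 8 * Real.exp T < w.im)
    (hw' : 8 * Real.exp T < w'.im) :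
    ‖poissonSeries s w' - poissonSeries t w‖
      ≤ 2 * (‖w' - w - (t - s) * poissonField w‖ + |t - s| * ‖w' - w‖) := by
  have hexp : 1 ≤ Real.exp T := Real.one_le_exp ((abs_nonneg t).trans ht.le)
  have hr {τ : ℝ} (hτ : τ ∈ Set.Icc (0 : ℝ) 1) : AffineMap.lineMap t s τ ∈ Set.Ioo (-T) T :=
    (convex_Ioo (-T) T).lineMap_mem (abs_lt.1 ht) (abs_lt.1 hs) hτ
  have hζ {τ : ℝ} (hτ : τ ∈ Set.Icc (0 : ℝ) 1) :
      8 * Real.exp T < (AffineMap.lineMap w w' τ : ℂ).im :=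
    (convex_halfSpace_im_gt _).lineMap_mem hw hw' hτ
  have hderiv {τ : ℝ} (hτ : τ ∈ Set.Icc (0 : ℝ) 1) :=
    hasDerivAt_poissonSeries_lineMap (hr hτ) (hζ hτ)
  have hmean := (convex_Icc (0 : ℝ) 1).norm_image_sub_le_of_norm_hasDerivWithin_le
    (C := 2 * (‖w' - w - (t - s) * poissonField w‖ + |t - s| * ‖w' - w‖))
    (fun τ hτ ↦ (hderiv hτ).hasDerivWithinAt) (fun τ hτ ↦ ?_) (Set.left_mem_Icc.2 zero_le_one)
    (Set.right_mem_Icc.2 zero_le_one)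
  · simpa using hmean
  · rw [norm_mul, mul_comm]
    gcongr
    · exact norm_poissonSeriesDeriv_le (abs_lt.2 (hr hτ)).le
        ((hζ hτ).le.trans ((le_abs_self _).trans (Complex.abs_im_le_norm _)))
    · simpa using norm_sub_sub_mul_poissonField_lineMap_le (by linarith) (by linarith) hτ (t - s)

end Transport

section LawOfSmallNumbers

/-- The distance of the rescaled moments `N M_k(μ)`, `k = 1, …, 4`, to the constant `c`, in the form
in which it enters the estimate of `H_μ(w) - w`. -/
noncomputable def momentDefect (μ : ProbabilityMeasure ℝ) (N c : ℝ) : ℝ :=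
  |N * moment μ 1 - c| + |N * moment μ 2 - c| + |N * (moment μ 3 - moment μ 2)|
    + N * (moment μ 4 - 2 * moment μ 3 + moment μ 2)

variable {μ : ProbabilityMeasure ℝ} {N c ε : ℝ} {w z : ℂ}

theorem norm_weightedCauchy_sub_one_sq_mul_sq_le
    (h4 : Integrable (fun x ↦ x ^ 4) (μ : Measure ℝ)) (hw : 1 ≤ w.im) :
    ‖weightedCauchy μ (fun x ↦ (x - 1) * ((x - 1) * x ^ 2)) w‖
      ≤ moment μ 4 - 2 * moment μ 3 + moment μ 2 := by
  have h3 := integrable_pow_of_le (show 3 ≤ 4 by norm_num) h4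
  have h2 := integrable_pow_of_le (show 2 ≤ 4 by norm_num) h4
  have hexpand (x : ℝ) : (x - 1) * ((x - 1) * x ^ 2) = x ^ 4 - 2 * x ^ 3 + x ^ 2 := by ring
  have hnonneg (x : ℝ) : 0 ≤ x ^ 4 - 2 * x ^ 3 + x ^ 2 := by
    nlinarith [sq_nonneg ((x - 1) * x)]
  have h43 : Integrable (fun x ↦ x ^ 4 - 2 * x ^ 3) (μ : Measure ℝ) := h4.sub (h3.const_mul 2)
  have hint : ∫ x, |x ^ 4 - 2 * x ^ 3 + x ^ 2| ∂(μ : Measure ℝ)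
      = moment μ 4 - 2 * moment μ 3 + moment μ 2 := by
    simp only [abs_of_nonneg (hnonneg _), moment]
    rw [integral_add h43 h2, integral_sub h4 (h3.const_mul 2), integral_const_mul]
  have hintegrable : Integrable (fun x ↦ x ^ 4 - 2 * x ^ 3 + x ^ 2) (μ : Measure ℝ) := h43.add h2
  simp only [hexpand]
  refine (norm_weightedCauchy_le hintegrable (by linarith)).trans ?_
  rw [hint, abs_of_nonneg (by linarith)]
  exact mul_le_of_le_one_left (hint ▸ integral_nonneg fun x ↦ abs_nonneg _)
    (inv_le_one_of_one_le₀ hw)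

theorem weightedCauchy_sq_eq (h4 : Integrable (fun x ↦ x ^ 4) (μ : Measure ℝ)) (hw : 1 ≤ w.im) :
    weightedCauchy μ (fun x ↦ x ^ 2) w = moment μ 2 * (w - 1)⁻¹
      + ((moment μ 3 - moment μ 2 : ℝ)
        + weightedCauchy μ (fun x ↦ (x - 1) * ((x - 1) * x ^ 2)) w) * (w - 1)⁻¹ ^ 2 := by
  have h3 := integrable_pow_of_le (show 3 ≤ 4 by norm_num) h4
  have h2 := integrable_pow_of_le (show 2 ≤ 4 by norm_num) h4
  have hw0 : w.im ≠ 0 := by linarith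
  have hw1 : w - 1 ≠ 0 := sub_ne_zero.2 (ne_one_of_one_le_im hw)
  have hexpand (x : ℝ) : (x - 1) * x ^ 2 = x ^ 3 - x ^ 2 := by ring
  have h32 : Integrable (fun x ↦ (x - 1) * x ^ 2) (μ : Measure ℝ) := by
    simp only [hexpand]
    exact h3.sub h2
  have hint : ∫ x, (x - 1) * x ^ 2 ∂(μ : Measure ℝ) = moment μ 3 - moment μ 2 := by
    simp only [hexpand]
    exact integral_sub h3 h2
  have hstep₁ := sub_ofReal_mul_weightedCauchy h2 hw0 1
  have hstep₂ := sub_ofReal_mul_weightedCauchy h32 hw0 1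
  rw [hint] at hstep₂
  rw [Complex.ofReal_one] at hstep₁ hstep₂
  rw [← moment] at hstep₁
  set W := weightedCauchy μ (fun x ↦ x ^ 2) w
  set J := weightedCauchy μ (fun x ↦ (x - 1) * ((x - 1) * x ^ 2)) w
  field_simp
  linear_combination (w - 1) * hstep₁ + hstep₂

theorem norm_mul_add_mul_poissonField_le (h4 : Integrable (fun x ↦ x ^ 4) (μ : Measure ℝ))
    (hN : 0 ≤ N) (hw : 1 ≤ w.im) :
    ‖N * (moment μ 1 + weightedCauchy μ (fun x ↦ x ^ 2) w) + c * poissonField w‖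
      ≤ momentDefect μ N c := by
  have hJ := norm_weightedCauchy_sub_one_sq_mul_sq_le h4 hw
  have hinv := norm_inv_sub_one_le hw
  rw [weightedCauchy_sq_eq h4 hw, poissonField_eq (ne_one_of_one_le_im hw), momentDefect]
  set J := weightedCauchy μ (fun x ↦ (x - 1) * ((x - 1) * x ^ 2)) w
  set i := (w - 1)⁻¹
  have hsq : ‖i ^ 2‖ ≤ 1 := by
    rw [norm_pow]
    exact pow_le_one₀ (norm_nonneg _) hinv
  have hreal (r : ℝ) {u : ℂ} (hu : ‖u‖ ≤ 1) : ‖r * u‖ ≤ |r| := by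
    rw [norm_mul, Complex.norm_real]
    exact mul_le_of_le_one_right (abs_nonneg r) hu
  calc _ = ‖(N * moment μ 1 - c : ℝ) * 1 + (N * moment μ 2 - c : ℝ) * i
        + (N * (moment μ 3 - moment μ 2) : ℝ) * i ^ 2 + N * (J * i ^ 2)‖ := by
        push_cast
        ring_nf
    _ ≤ _ := by
        refine (norm_add₄_le ..).trans (add_le_add (add_le_add (add_le_add
          (hreal _ (by simp)) (hreal _ hinv)) (hreal _ hsq)) ?_)
        rw [norm_mul, norm_mul, Complex.norm_real, Real.norm_of_nonneg hN]
        gcongr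
        exact (mul_le_of_le_one_right (norm_nonneg _) hsq).trans hJ

theorem norm_recipCauchy_sub_self_sub_poissonField_le
    (h4 : Integrable (fun x ↦ x ^ 4) (μ : Measure ℝ)) (hc : 0 ≤ c) (hN : 0 < N)
    (hlarge : 2 * (momentDefect μ N c + 2 * c) ≤ N) (hw : 1 ≤ w.im) :
    ‖recipCauchy μ w - w - (c / N : ℝ) * poissonField w‖
      ≤ (momentDefect μ N c + 2 * (momentDefect μ N c + 2 * c) ^ 2 / N) / N := by
  have hw1 : 1 ≤ ‖w‖ := hw.trans ((le_abs_self _).trans (Complex.abs_im_le_norm w))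
  have hdefect := norm_mul_add_mul_poissonField_le (c := c) h4 hN.le hw
  have hH := recipCauchy_mul_add (integrable_pow_of_le (show 2 ≤ 4 by norm_num) h4)
    (by linarith : 0 < w.im)
  have hmom : moment μ 1 = ∫ x, x ∂(μ : Measure ℝ) := by simp [moment]
  rw [← hmom] at hH
  set D := momentDefect μ N c
  set a := moment μ 1 + weightedCauchy μ (fun x ↦ x ^ 2) w
  set V := poissonField w
  have hNa : N * ‖a‖ ≤ D + 2 * c :=
    calc N * ‖a‖ = ‖N * a + c * V - c * V‖ := by
          rw [add_sub_cancel_right, norm_mul, Complex.norm_real, Real.norm_of_nonneg hN.le]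
      _ ≤ D + c * 2 := by
          refine (norm_sub_le _ _).trans (add_le_add hdefect ?_)
          rw [norm_mul, Complex.norm_real, Real.norm_of_nonneg hc]
          gcongr
          exact norm_poissonField_le hw
      _ = D + 2 * c := by ring
  have ha : ‖a‖ ≤ (D + 2 * c) / N := (le_div_iff₀' hN).2 hNa
  have hquad : ‖recipCauchy μ w - w + a‖ ≤ 2 * ‖a‖ ^ 2 :=
    norm_sub_add_le_of_mul_add_eq_sq hH hw1 (by nlinarith)
  have hNc : (N : ℂ) ≠ 0 := mod_cast hN.ne'
  calc _ = ‖(recipCauchy μ w - w + a) - (N * a + c * V) / N‖ := by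
        push_cast
        congr 1
        field_simp
        ring
    _ ≤ 2 * ((D + 2 * c) / N) ^ 2 + D / N := by
        refine (norm_sub_le _ _).trans (add_le_add (hquad.trans (by gcongr)) ?_)
        rw [norm_div, Complex.norm_real, Real.norm_of_nonneg hN.le]
        gcongr
    _ = (D + 2 * (D + 2 * c) ^ 2 / N) / N := by
        field_simp
        ring

theorem norm_poissonSeries_recipCauchy_sub_le {t T : ℝ} (hc : 0 ≤ c) (hN : 0 < N)
    (hstep : ‖recipCauchy μ w - w - (c / N : ℝ) * poissonField w‖ ≤ ε / N) (ht : |t| < T)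
    (hs : |t - c / N| < T) (hw : 8 * Real.exp T < w.im) :
    ‖poissonSeries (t - c / N) (recipCauchy μ w) - poissonSeries t w‖
      ≤ 2 * (ε + c * (ε + 2 * c) / N) / N := by
  have hw1 : 1 ≤ w.im := by linarith [Real.one_le_exp ((abs_nonneg t).trans ht.le)]
  have him : w.im ≤ (recipCauchy μ w).im := im_le_im_iterate_recipCauchy μ 1 (by linarith)
  have hcN : 0 ≤ c / N := by positivity
  have hdist : ‖recipCauchy μ w - w‖ ≤ (ε + 2 * c) / N :=
    calc _ = ‖(recipCauchy μ w - w - (c / N : ℝ) * poissonField w)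
          + (c / N : ℝ) * poissonField w‖ := by rw [sub_add_cancel]
      _ ≤ ε / N + c / N * 2 := by
          refine (norm_add_le _ _).trans (add_le_add hstep ?_)
          rw [norm_mul, Complex.norm_real, Real.norm_of_nonneg hcN]
          gcongr
          exact norm_poissonField_le hw1
      _ = (ε + 2 * c) / N := by ring
  have hmain := norm_poissonSeries_sub_le ht hs hw (hw.trans_le him)
  rw [← Complex.ofReal_sub, sub_sub_cancel, abs_of_nonneg hcN] at hmain
  calc _ ≤ 2 * (ε / N + c / N * ((ε + 2 * c) / N)) := hmain.trans (by gcongr)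
    _ = 2 * (ε + c * (ε + 2 * c) / N) / N := by
        field_simp

/-- Along the iterates `H^k(z)` of an approximate time-`c/N` step of the flow, `poissonSeries` at
the remaining time `c - k c / N` is almost constant; it starts at `poissonSeries c z` and ends at
`1 / H^N(z)`. -/
theorem norm_inv_iterate_recipCauchy_sub_poissonSeries_le {N : ℕ} (hN : N ≠ 0) (hc : 0 ≤ c)
    (hstep : ∀ w : ℂ, 1 ≤ w.im →
      ‖recipCauchy μ w - w - (c / N : ℝ) * poissonField w‖ ≤ ε / N)
    (hz : 8 * Real.exp (c + 1) < z.im) :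
    ‖((recipCauchy μ)^[N] z)⁻¹ - poissonSeries c z‖ ≤ 2 * (ε + c * (ε + 2 * c) / N) := by
  have hN0 : (0 : ℝ) < N := by positivity
  have hz0 : 0 < z.im := hz.trans' (by positivity)
  have him (k : ℕ) : 8 * Real.exp (c + 1) < ((recipCauchy μ)^[k] z).im :=
    hz.trans_le (im_le_im_iterate_recipCauchy μ k hz0)
  have hexp : 1 ≤ Real.exp (c + 1) := Real.one_le_exp (by linarith)
  have htime {k : ℕ} (hk : k ≤ N) : |c - k * (c / N)| < c + 1 := by
    have hle : k * (c / N) ≤ N * (c / N) := by gcongr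
    rw [mul_div_cancel₀ c hN0.ne'] at hle
    have hnonneg : 0 ≤ k * (c / N) := by positivity
    rw [abs_of_nonneg] <;> linarith
  set f : ℕ → ℂ := fun k ↦ poissonSeries (c - k * (c / N)) ((recipCauchy μ)^[k] z) with hf
  have hf0 : f 0 = poissonSeries c z := by simp [hf]
  have hfN : f N = ((recipCauchy μ)^[N] z)⁻¹ := by
    simp only [hf, mul_div_cancel₀ c hN0.ne', sub_self, poissonSeries_zero]
  have hsucc {k : ℕ} (hk : k < N) :
      dist (f k) (f (k + 1)) ≤ 2 * (ε + c * (ε + 2 * c) / N) / N := by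
    have hadd : c - (k + 1 : ℕ) * (c / N) = c - k * (c / N) - c / N := by
      push_cast
      ring
    rw [dist_comm, dist_eq_norm]
    simp only [hf, hadd, Function.iterate_succ_apply']
    exact norm_poissonSeries_recipCauchy_sub_le hc hN0 (hstep _ (by linarith [him k]))
      (htime hk.le) (hadd ▸ htime hk) (him k)
  have hsum := dist_le_range_sum_of_dist_le N hsucc
  rwa [hf0, hfN, Finset.sum_const, Finset.card_range, nsmul_eq_mul, mul_div_cancel₀ _ hN0.ne',
    dist_comm, dist_eq_norm] at hsum

end LawOfSmallNumbers

section MonotonePoisson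

variable {c : ℝ} {μ : ℕ → ProbabilityMeasure ℝ} {ρ : ProbabilityMeasure ℝ} {z : ℂ}

theorem tendsto_momentDefect
    (hm : ∀ k ∈ Finset.Icc 1 4, Tendsto (fun N : ℕ ↦ N * moment (μ N) k) atTop (𝓝 c)) :
    Tendsto (fun N : ℕ ↦ momentDefect (μ N) N c) atTop (𝓝 0) := by
  have h1 := hm 1 (by simp)
  have h2 := hm 2 (by simp)
  have h3 := hm 3 (by simp)
  have h4 := hm 4 (by simp)
  have habs := (((h1.sub_const c).abs).add ((h2.sub_const c).abs)).add ((h3.sub h2).abs)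
  have hsq := (h4.sub (h3.const_mul 2)).add h2
  convert habs.add hsq using 2 with N
  · rw [momentDefect]
    ring_nf
  · simp only [sub_self, abs_zero]
    ring

theorem tendsto_cauchyTransform_monotoneConvPow (hc : 0 ≤ c)
    (h4 : ∀ᶠ N in atTop, Integrable (fun x ↦ x ^ 4) (μ N : Measure ℝ))
    (hm : ∀ k ∈ Finset.Icc 1 4, Tendsto (fun N : ℕ ↦ N * moment (μ N) k) atTop (𝓝 c))
    (hz : 8 * Real.exp (c + 1) < z.im) :
    Tendsto (fun N ↦ cauchyTransform (monotoneConvPow (μ N) N) z) atTop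
      (𝓝 (poissonSeries c z)) := by
  have hD := tendsto_momentDefect hm
  have hN : Tendsto (fun N : ℕ ↦ (N : ℝ)) atTop atTop := tendsto_natCast_atTop_atTop
  set D : ℕ → ℝ := fun N ↦ momentDefect (μ N) N c
  set ε : ℕ → ℝ := fun N ↦ D N + 2 * (D N + 2 * c) ^ 2 / N
  have hε : Tendsto ε atTop (𝓝 0) := by
    simpa using hD.add ((((hD.add_const (2 * c)).pow 2).const_mul 2).div_atTop hN)
  have hbound : Tendsto (fun N : ℕ ↦ 2 * (ε N + c * (ε N + 2 * c) / N)) atTop (𝓝 0) := by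
    simpa using (hε.add (((hε.add_const (2 * c)).const_mul c).div_atTop hN)).const_mul 2
  have hlarge : ∀ᶠ N : ℕ in atTop, 2 * (D N + 2 * c) ≤ N := by
    filter_upwards [hD.eventually_le_const zero_lt_one, hN.eventually_ge_atTop (2 * (1 + 2 * c))]
      with N hDN hNN
    linarith
  refine tendsto_iff_norm_sub_tendsto_zero.2 (squeeze_zero' (.of_forall fun N ↦ norm_nonneg _) ?_
    hbound)
  filter_upwards [h4, hlarge, eventually_ne_atTop 0] with N h4N hlargeN hN0
  rw [cauchyTransform_monotoneConvPow _ _ (hz.trans' (by positivity))]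
  exact norm_inv_iterate_recipCauchy_sub_poissonSeries_le hN0 hc (fun w hw ↦
    norm_recipCauchy_sub_self_sub_poissonField_le h4N hc (by positivity) hlargeN hw) hz

theorem isMonotonePoisson_iff :
    IsMonotonePoisson c ρ ↔ HasAllMoments ρ ∧ moment ρ = fun n ↦ (poissonPoly n).eval c := by
  refine and_congr_right fun _ ↦ ⟨fun h ↦ funext fun n ↦ ?_, fun h n hn ↦ ?_⟩
  · rcases n.eq_zero_or_pos with rfl | hn
    · simp [moment, poissonPoly_zero]
    · rw [h n hn, eval_poissonPoly_eq_monotonePoissonMoment hn]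
  · simp only [h, eval_poissonPoly_eq_monotonePoissonMoment hn]

theorem abs_eval_poissonPoly_le_of_nonneg (hc : 0 ≤ c) (n : ℕ) :
    |(poissonPoly n).eval c| ≤ 1 * (2 * Real.exp (c + 1)) ^ n := by
  rw [one_mul]
  exact abs_eval_poissonPoly_le (by rw [abs_of_nonneg hc]; linarith) n

theorem IsMonotonePoisson.cauchyTransform_eq (hc : 0 ≤ c) (hρ : IsMonotonePoisson c ρ)
    (hz : 8 * Real.exp (c + 1) < z.im) : cauchyTransform ρ z = poissonSeries c z := by
  obtain ⟨hint, hmom⟩ := isMonotonePoisson_iff.1 hρ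
  rw [cauchyTransform_eq_momentSeries hint (A := 1) (C := 2 * Real.exp (c + 1)) (by positivity)
    (by simpa only [hmom] using abs_eval_poissonPoly_le_of_nonneg hc)
    (by linarith [Real.exp_pos (c + 1)]), hmom, poissonSeries]

theorem moment_bernoulliMeasure (p : unitInterval) {k : ℕ} (hk : k ≠ 0) :
    moment ⟨bernoulliMeasure 1 0 p, inferInstance⟩ k = p := by
  simp [moment, integral_bernoulliMeasure, hk]

theorem exists_tendsto_mul_moment (hc : 0 ≤ c) : ∃ μ : ℕ → ProbabilityMeasure ℝ,
    (∀ N, HasAllMoments (μ N)) ∧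
      ∀ k ≠ 0, Tendsto (fun N : ℕ ↦ N * moment (μ N) k) atTop (𝓝 c) := by
  refine ⟨fun N ↦ ⟨bernoulliMeasure 1 0 (Set.projIcc 0 1 zero_le_one (c / N)), inferInstance⟩,
    fun N k ↦ integrable_bernoulliMeasure _ _ _ _, fun k hk ↦ ?_⟩
  refine tendsto_const_nhds.congr' ?_
  filter_upwards [eventually_gt_atTop 0, eventually_ge_atTop ⌈c⌉₊] with N hN hcN
  have hN0 : (0 : ℝ) < N := mod_cast hN
  rw [moment_bernoulliMeasure _ hk, Set.projIcc_of_mem zero_le_one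
    ⟨by positivity, (div_le_one hN0).2 (Nat.ceil_le.1 hcN)⟩, mul_div_cancel₀ c hN0.ne']

theorem existsUnique_isMonotonePoisson (hc : 0 ≤ c) :
    ∃! ρ : ProbabilityMeasure ℝ, IsMonotonePoisson c ρ := by
  have hC : 0 < 2 * Real.exp (c + 1) := by positivity
  have hR : 0 ≤ 8 * Real.exp (c + 1) := by positivity
  have hm := abs_eval_poissonPoly_le_of_nonneg hc
  obtain ⟨μ, hμ, hμm⟩ := exists_tendsto_mul_moment hc
  have hlim : Tendsto (fun y : ℝ ↦ y * Complex.I * poissonSeries c (y * Complex.I)) atTop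
      (𝓝 1) := by
    simpa [poissonSeries, poissonPoly_zero] using tendsto_mul_momentSeries_mul_I hC hm
  obtain ⟨ρ, hρ⟩ := exists_cauchyTransform_eq_of_tendsto hR (fun z hz ↦
    tendsto_cauchyTransform_monotoneConvPow hc (.of_forall fun N ↦ hμ N 4)
      (fun k hk ↦ hμm k (by grind)) hz) hlim
  refine ⟨ρ, isMonotonePoisson_iff.2 (hasAllMoments_of_cauchyTransform_eq hC hm ?_),
    fun σ hσ ↦ eq_of_cauchyTransform_eq_of_im_gt hR fun z hz ↦ ?_⟩
  · filter_upwards [eventually_gt_atTop (8 * Real.exp (c + 1))] with y hy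
    exact hρ _ (by simpa using hy)
  · rw [hσ.cauchyTransform_eq hc hz, hρ z hz]

theorem tendsto_monotoneConvPow_monotonePoisson (hc : 0 ≤ c)
    (h4 : ∀ᶠ N in atTop, Integrable (fun x ↦ x ^ 4) (μ N : Measure ℝ))
    (hm : ∀ k ∈ Finset.Icc 1 4, Tendsto (fun N : ℕ ↦ N * moment (μ N) k) atTop (𝓝 c)) :
    Tendsto (fun N ↦ monotoneConvPow (μ N) N) atTop (𝓝 (monotonePoisson c)) := by
  have hP : IsMonotonePoisson c (monotonePoisson c) :=
    Classical.epsilon_spec (existsUnique_isMonotonePoisson hc).exists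
  refine tendsto_of_tendsto_cauchyTransform (R := 8 * Real.exp (c + 1)) (by positivity)
    fun z hz ↦ ?_
  rw [hP.cauchyTransform_eq hc hz]
  exact tendsto_cauchyTransform_monotoneConvPow hc h4 hm hz

end MonotonePoisson

end MonotoneConv

theorem mainTheorem6_general :
    (∀ μ ν : ProbabilityMeasure ℝ, ∃! ρ : ProbabilityMeasure ℝ,
      MonotoneConv.IsMonotoneConv μ ν ρ) ∧
    (∀ c : ℝ, 0 ≤ c → ∃! ρ : ProbabilityMeasure ℝ, MonotoneConv.IsMonotonePoisson c ρ) ∧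
    (∀ μ : ProbabilityMeasure ℝ,
      ∫ x : ℝ, x ∂(μ : Measure ℝ) = 0 → variance (fun x : ℝ ↦ x) (μ : Measure ℝ) = 1 →
      Tendsto (fun N : ℕ ↦
          MonotoneConv.monotoneConvPow (MonotoneConv.dilation (1 / √(N : ℝ)) μ) N)
        atTop (𝓝 MonotoneConv.arcsineLaw)) ∧
    (∀ (μ : ℕ → ProbabilityMeasure ℝ) (c : ℝ), 0 ≤ c →
      (∀ᶠ N in atTop, Integrable (fun x : ℝ ↦ x ^ 4) (μ N : Measure ℝ)) →
      (∀ k ∈ Finset.Icc 1 4,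
        Tendsto (fun N : ℕ ↦ (N : ℝ) * MonotoneConv.moment (μ N) k) atTop (𝓝 c)) →
      Tendsto (fun N : ℕ ↦ MonotoneConv.monotoneConvPow (μ N) N)
        atTop (𝓝 (MonotoneConv.monotonePoisson c))) :=
  ⟨MonotoneConv.existsUnique_isMonotoneConv,
    fun _ ↦ MonotoneConv.existsUnique_isMonotonePoisson,
    fun _ ↦ MonotoneConv.tendsto_monotoneConvPow_arcsineLaw,
    fun _ _ ↦ MonotoneConv.tendsto_monotoneConvPow_monotonePoisson⟩

theorem mainTheorem6 :
    -- the monotone convolution and the monotone Poisson distribution are well defined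
    (∀ μ ν : ProbabilityMeasure ℝ, ∃! ρ : ProbabilityMeasure ℝ,
      MonotoneConv.IsMonotoneConv μ ν ρ) ∧
    (∀ c : ℝ, 0 < c → ∃! ρ : ProbabilityMeasure ℝ, MonotoneConv.IsMonotonePoisson c ρ) ∧
    -- central limit theorem
    (∀ μ : ProbabilityMeasure ℝ, MonotoneConv.HasAllMoments μ →
      ∫ x : ℝ, x ∂(μ : Measure ℝ) = 0 → variance (fun x : ℝ => x) (μ : Measure ℝ) = 1 →
      Tendsto (fun N : ℕ =>
          MonotoneConv.monotoneConvPow (MonotoneConv.dilation (1 / √(N : ℝ)) μ) N)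
        atTop (𝓝 MonotoneConv.arcsineLaw)) ∧
    -- law of small numbers
    (∀ (μ : ℕ → ProbabilityMeasure ℝ) (c : ℝ), 0 < c →
      (∀ N : ℕ, 1 ≤ N → MonotoneConv.HasAllMoments (μ N)) →
      (∀ k : ℕ, 1 ≤ k →
        Tendsto (fun N : ℕ => (N : ℝ) * MonotoneConv.moment (μ N) k) atTop (𝓝 c)) →
      Tendsto (fun N : ℕ => MonotoneConv.monotoneConvPow (μ N) N)
        atTop (𝓝 (MonotoneConv.monotonePoisson c))) := by
  obtain ⟨hconv, hpoisson, hclt, hsmall⟩ := mainTheorem6_general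
  exact ⟨hconv, fun c hc ↦ hpoisson c hc.le, fun μ _ ↦ hclt μ, fun μ c hc hμ hm ↦
    hsmall μ c hc.le (eventually_atTop.2 ⟨1, fun N hN ↦ hμ N hN 4⟩)
      fun k hk ↦ hm k (Finset.mem_Icc.1 hk).1⟩
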